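/- **Setting.** Let $d\ge 1$, $D=\binom d2$. Index the entries of $x\in\mathbb R^D$ by the pairs $(ij)$, $1\le i<j\le d$; let $\mathcal A(x)$ be the symmetric $d\times d$ matrix with zero diagonal and upper triangular entries $x$, and $\mathcal L(x)=\operatorname{diag}(\mathcal A(x)\mathbf 1)-\mathcal A(x)$. $|x|$ is the entrywise absolute value, $\lambda_{(j)}(\cdot)$ the $j$-th smallest eigenvalue of a symmetric matrix, $\|\cdot\|_{op}$ the spectral norm and $\|\cdot\|_F$ the Frobenius norm. *Target.* Fix $\beta^*\in\mathbb R^D$. The graph $\mathcal G^*$ on $\{1,\dots,d\}$ has the edge $ij$ iff $\mathcal A(\beta^*)_{ij}\ne0$; $K^*$ is its number of connected components, assumed $<d$ (i.e. $\beta^*\neq 0$); $d^*_{\max}$ is the number of nodes of its largest component; $S$ is the set of $(ij)$ with $i,j$ in the same component, $S^C$ its complement; $\triangle^*=\lambda_{(K^*+1)}(\mathcal L(|\beta^*|))>0$ is the target spectral gap. *Penalty.* Let $a_0\ge a_1>0$, $b_2>b_1>0$, $\tau\ge0$. The function $g_\tau:[0,\infty)\to\mathbb R$ is nondecreasing and concave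 with $g_\tau(0)=0$, differentiable on $(0,\infty)$, with $g_\tau'(0):=g_\tau'(0+)=a_0\tau$, $g_\tau'(t)\ge a_1\tau$ for $t\in(0,b_1\tau]$ and $g_\tau'(t)=0$ for $t\ge b_2\tau$. *LLA step.* Let $\ell:\mathbb R^D\to\mathbb R$ be convex. One LLA step from $\beta$: let $V$ be an orthogonal matrix of eigenvectors of $\mathcal L(|\beta|)$ with eigenvalues $\lambda_1,\dots,\lambda_d$, put $M_{(ij)}=\sum_k g_\tau'(\lambda_k)(V_{ik}-V_{jk})^2$, and return a minimizer over $b\in\mathbb R^D$ of $\ell(b)+\frac12\sum_{(ij)}M_{(ij)}|b_{(ij)}|$. *Oracles.* Assume that the block oracle $\hat\beta^{\mathrm{oracle}}$ is the unique minimizer of $\ell(\beta)$ subject to $\beta_{S^C}=0$ and that, for every $w\in\mathbb R^D_+$ with $w_{S^C}=0$, the Lasso oracle problem $$\min_\beta\ \ell(\beta)+\tfrac12\sum_{(ij)\in S}w_{(ij)}|\beta_{(ij)}|\quad\text{subject to }\beta_{S^C}=0 \tag{$P_w$}$$ has a unique solution. For $\rho\ge0$ let $\mathcal O_{op}(\rho,\tau)$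 be the set of all minimizers of $(P_w)$ for some $w\in\mathbb R^D_+$ with $w_{S^C}=0$ and $\|w\|_{\max}\le 2^5a_0\tau\rho^2$; let $\mathcal O_{F}(\rho,\tau)$ be defined in the same way with the additional requirements $\|w\|_2\le 2^{9/2}(d^*_{\max})^{1/2}a_0\tau\rho^2$ and $\|w\|_1\le 2^4d^*_{\max}a_0\tau\rho^2$. *Regularity sets.* $\mathcal N(t)$ is the set of $\beta$ at which $\ell$ is differentiable and all entries of $\nabla\ell(\beta)$ in $S^C$ are $<t$ in absolute value. $\mathcal B(t)$ is the set of $\beta$ such that, for every connected component $C$ of $\mathcal G^*$ with at least two nodes, the Laplacian of the weighted graph $|\beta|$ restricted to the nodes of $C$ has second smallest eigenvalue $\ge t$. **Theorem.** Let $\rho\ge0$ and let $\beta^{(0)}\in\mathbb R^D$ satisfy $\lambda_{(K^*)}(\mathcal L(|\beta^{(0)}|))\le b_1\tau$ and $\lambda_{(K^*+1)}(\mathcal L(|\beta^{(0)}|))\ge b_2\tau$. (Operator version.) Suppose $$\frac{\|\mathcal L(|\beta^{(0)}|-|\beta^*|)\|_{op}}{\triangle^*}\le\min\Big(\rho,\frac1{2^6}\sqrt{\frac{a_1}{a_0d^*_{\max}}}\Big)\quad\text{and}\quad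 \mathcal O_{op}(\rho,\tau)\subseteq\mathcal N\Big(\frac{a_1\tau}{4d^*_{\max}}\Big).$$ Then the LLA step from $\beta^{(0)}$ has exactly one possible result $\hat\beta^{(1)}$, and $\hat\beta^{(1)}\in\mathcal O_{op}(\rho,\tau)$. If in addition $\mathcal O_{op}(\rho,\tau)\subseteq\mathcal B(b_2\tau)$, then the LLA step from $\hat\beta^{(1)}$ results in, and only in, $\hat\beta^{(2)}=\hat\beta^{\mathrm{oracle}}$, and the LLA step from $\hat\beta^{\mathrm{oracle}}$ again results in, and only in, $\hat\beta^{\mathrm{oracle}}$; that is, the algorithm has converged to the block oracle. (Frobenius version.) The same statements hold with $\mathcal O_F(\rho,\tau)$ in place of $\mathcal O_{op}(\rho,\tau)$ throughout if the first displayed condition is replaced by $$\min\Big(\|\mathcal L(|\beta^{(0)}|-|\beta^*|)\|_F,\ \sqrt{K^*}\,\|\mathcal L(|\beta^{(0)}|-|\beta^*|)\|_{op}\Big)\le\triangle^*\cdot\min\Big(\rho,\frac1{2^6}\sqrt{\frac{a_1}{a_0d^*_{\max}}}\Big).$$ -/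

import Mathlib

open Set Filter Topology

noncomputable section

namespace BlockLLA

/-- The `D = d.choose 2` edges on the nodes `Fin d`; edge vectors are functions `Edge d → ℝ`. -/
abbrev Edge (d : ℕ) : Type := {p : Fin d × Fin d // p.1 < p.2}

/-- The hollow symmetric matrix whose upper triangular entries are given by `x`. -/
def adj {d : ℕ} (x : Edge d → ℝ) : Matrix (Fin d) (Fin d) ℝ := fun i j =>
  if h : i < j then x ⟨(i, j), h⟩ else if h : j < i then x ⟨(j, i), h⟩ else 0

theorem adj_symm {d : ℕ} (x : Edge d → ℝ) (i j : Fin d) : adj x i j = adj x j i := by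
  unfold adj
  rcases lt_trichotomy i j with h | h | h
  · simp [h, h.not_gt]
  · simp [h]
  · simp [h, h.not_gt]

theorem adj_self {d : ℕ} (x : Edge d → ℝ) (i : Fin d) : adj x i i = 0 := by
  simp [adj]

/-- The entrywise absolute value of an edge vector. -/
def absVec {d : ℕ} (x : Edge d → ℝ) : Edge d → ℝ := fun e => |x e|

/-- The Laplacian `diag (A 1) - A`. -/
def lap {V : Type*} [Fintype V] [DecidableEq V] (A : Matrix V V ℝ) : Matrix V V ℝ :=
  Matrix.diagonal (fun i => ∑ j, A i j) - A

theorem lap_isHermitian {V : Type*} [Fintype V] [DecidableEq V] {A : Matrix V V ℝ}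
    (hA : ∀ i j, A i j = A j i) : (lap A).IsHermitian := by
  ext i j
  by_cases h : i = j
  · subst h; simp [lap]
  · have h2 : j ≠ i := fun h3 => h h3.symm
    simp [lap, Matrix.diagonal, h, h2, hA i j]

/-- The `j`-th smallest eigenvalue (`1 ≤ j ≤ |V|`, with multiplicity) of a symmetric real matrix.
Mathlib's `eigenvalues₀` lists the eigenvalues in decreasing order. -/
def smallEig {V : Type*} [Fintype V] [DecidableEq V] (A : Matrix V V ℝ) (j : ℕ) : ℝ :=
  if h : A.IsHermitian ∧ 1 ≤ j ∧ j ≤ Fintype.card V then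
    h.1.eigenvalues₀ ⟨Fintype.card V - j, by omega⟩
  else 0

/-- The operator norm of a matrix with respect to Euclidean norms. -/
def opNorm {V : Type*} [Fintype V] [DecidableEq V] (A : Matrix V V ℝ) : ℝ :=
  ‖Matrix.toEuclideanCLM (n := V) (𝕜 := ℝ) A‖

/-- The Frobenius norm of a matrix. -/
def frobNorm {V : Type*} [Fintype V] (A : Matrix V V ℝ) : ℝ :=
  Real.sqrt (∑ i, ∑ j, A i j ^ 2)

/-! ### Graph quantities of the target -/

/-- The graph on `Fin d` whose edges are the nonzero entries of `β`. -/
def supportGraph {d : ℕ} (β : Edge d → ℝ) : SimpleGraph (Fin d) where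
  Adj i j := adj β i j ≠ 0
  symm := ⟨fun i j h => by rw [adj_symm]; exact h⟩
  loopless := ⟨fun i h => h (adj_self β i)⟩

/-- The number of connected components (isolated nodes included). -/
def numComp {d : ℕ} (β : Edge d → ℝ) : ℕ := Nat.card (supportGraph β).ConnectedComponent

/-- The number of nodes of the largest connected component. -/
def maxComp {d : ℕ} (β : Edge d → ℝ) : ℕ :=
  ⨆ c : (supportGraph β).ConnectedComponent, c.supp.ncard

open Classical in
/-- The block support: edges whose two nodes are in the same connected component. -/
def blockSupp {d : ℕ} (β : Edge d → ℝ) : Finset (Edge d) :=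
  Finset.univ.filter fun e => (supportGraph β).Reachable e.1.1 e.1.2

/-- The target spectral gap, the `(K + 1)`-st smallest eigenvalue of the Laplacian of `|β|`, where
`K` is the number of connected components of `β`. -/
def specGap {d : ℕ} (β : Edge d → ℝ) : ℝ :=
  smallEig (lap (adj (absVec β))) (numComp β + 1)

/-! ### Penalty -/

/-- The derivative of the penalty on `[0, ∞)`, with the convention `g'(0) = a₀ τ`. -/
def penDeriv (a₀ τ : ℝ) (g : ℝ → ℝ) (t : ℝ) : ℝ := if 0 < t then deriv g t else a₀ * τ

/-- SCAD-like concave penalty functions on `[0, ∞)` (values of `g` at negative reals are not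
used). -/
structure IsScadLike (a₀ a₁ b₁ b₂ τ : ℝ) (g : ℝ → ℝ) : Prop where
  a₁_pos : 0 < a₁
  a₁_le : a₁ ≤ a₀
  b₁_pos : 0 < b₁
  b₁_lt : b₁ < b₂
  mono : MonotoneOn g (Ici 0)
  concave : ConcaveOn ℝ (Ici 0) g
  map_zero : g 0 = 0
  diff : ∀ t, 0 < t → DifferentiableAt ℝ g t
  deriv_zero : Tendsto (deriv g) (𝓝[>] 0) (𝓝 (a₀ * τ))
  deriv_ge : ∀ t, 0 < t → t ≤ b₁ * τ → a₁ * τ ≤ penDeriv a₀ τ g t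
  deriv_flat : ∀ t, b₂ * τ ≤ t → penDeriv a₀ τ g t = 0

/-! ### The LLA algorithm -/

/-- The Laplacian coefficient: `M(V, w)_(ij) = ∑ k, w k (V i k - V j k)²`. -/
def lapCoeff {d : ℕ} {κ : Type*} [Fintype κ] (V : Matrix (Fin d) κ ℝ) (w : κ → ℝ) :
    Edge d → ℝ :=
  fun e => ∑ k, w k * (V e.1.1 k - V e.1.2 k) ^ 2

/-- `β'` is a result of one LLA step from `β`: for some orthogonal matrix `V` of eigenvectors of the
Laplacian of `|β|`, with eigenvalues `μ`, it is a global minimizer of the weighted Lasso problem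
with weights `M(V, g'(μ))`. -/
def IsLLAStep {d : ℕ} (ℓ : (Edge d → ℝ) → ℝ) (a₀ τ : ℝ) (g : ℝ → ℝ) (β β' : Edge d → ℝ) : Prop :=
  ∃ (V : Matrix (Fin d) (Fin d) ℝ) (μ : Fin d → ℝ),
    V ∈ Matrix.orthogonalGroup (Fin d) ℝ ∧
    lap (adj (absVec β)) * V = V * Matrix.diagonal μ ∧
    ∀ b : Edge d → ℝ,
      ℓ β' + 1 / 2 * ∑ e, |β' e| * lapCoeff V (fun k => penDeriv a₀ τ g (μ k)) e ≤
        ℓ b + 1 / 2 * ∑ e, |b e| * lapCoeff V (fun k => penDeriv a₀ τ g (μ k)) e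

/-! ### Oracle problems, for a target `βs` -/

/-- `β` solves the block oracle problem: minimize `ℓ` subject to vanishing off the block support. -/
def IsBlockOracle {d : ℕ} (ℓ : (Edge d → ℝ) → ℝ) (βs β : Edge d → ℝ) : Prop :=
  (∀ e, e ∉ blockSupp βs → β e = 0) ∧
    ∀ b : Edge d → ℝ, (∀ e, e ∉ blockSupp βs → b e = 0) → ℓ β ≤ ℓ b

/-- Admissible weights of the Lasso block oracle problem: nonnegative, zero off the block support. -/
def IsWeight {d : ℕ} (βs w : Edge d → ℝ) : Prop :=
  (∀ e, 0 ≤ w e) ∧ ∀ e, e ∉ blockSupp βs → w e = 0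

/-- `β` solves the Lasso block oracle problem with weights `w`. -/
def IsLassoOracle {d : ℕ} (ℓ : (Edge d → ℝ) → ℝ) (βs w β : Edge d → ℝ) : Prop :=
  (∀ e, e ∉ blockSupp βs → β e = 0) ∧
    ∀ b : Edge d → ℝ, (∀ e, e ∉ blockSupp βs → b e = 0) →
      ℓ β + 1 / 2 * ∑ e ∈ blockSupp βs, w e * |β e| ≤
        ℓ b + 1 / 2 * ∑ e ∈ blockSupp βs, w e * |b e|

/-- The set of Lasso block oracles with small weights, operator norm version. -/
def lassoOrcSetOp {d : ℕ} (ℓ : (Edge d → ℝ) → ℝ) (βs : Edge d → ℝ) (a₀ ρ τ : ℝ) :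
    Set (Edge d → ℝ) :=
  {β | ∃ w : Edge d → ℝ, IsWeight βs w ∧ (∀ e, |w e| ≤ 2 ^ 5 * a₀ * τ * ρ ^ 2) ∧
    IsLassoOracle ℓ βs w β}

/-- The set of Lasso block oracles with small weights, Frobenius norm version. -/
def lassoOrcSetFrob {d : ℕ} (ℓ : (Edge d → ℝ) → ℝ) (βs : Edge d → ℝ) (a₀ ρ τ : ℝ) :
    Set (Edge d → ℝ) :=
  {β | ∃ w : Edge d → ℝ, IsWeight βs w ∧ (∀ e, |w e| ≤ 2 ^ 5 * a₀ * τ * ρ ^ 2) ∧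
    Real.sqrt (∑ e, w e ^ 2) ≤
      (2 : ℝ) ^ (9 / 2 : ℝ) * Real.sqrt (maxComp βs) * a₀ * τ * ρ ^ 2 ∧
    ∑ e, |w e| ≤ 2 ^ 4 * (maxComp βs : ℝ) * a₀ * τ * ρ ^ 2 ∧
    IsLassoOracle ℓ βs w β}

/-! ### Regularity sets, for a target `βs` -/

/-- Points where `ℓ` has a gradient whose entries off the block support are all smaller than `t` in
absolute value. -/
def niceGradSet {d : ℕ} (ℓ : (Edge d → ℝ) → ℝ) (βs : Edge d → ℝ) (t : ℝ) : Set (Edge d → ℝ) :=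
  {β | DifferentiableAt ℝ ℓ β ∧
    ∀ e, e ∉ blockSupp βs → |fderiv ℝ ℓ β (Pi.single e 1)| < t}

open Classical in
/-- Points `β` such that for every connected component of the target with at least two nodes, the
Laplacian of `|β|` restricted to the nodes of that component has second smallest eigenvalue at least
`t`. -/
def bigEvalCompSet {d : ℕ} (βs : Edge d → ℝ) (t : ℝ) : Set (Edge d → ℝ) :=
  {β | ∀ c : (supportGraph βs).ConnectedComponent, 2 ≤ c.supp.ncard →
    t ≤ smallEig (lap (fun i j : c.supp => adj (absVec β) i j)) 2}

/-- Points with a large Laplacian spectral gap after the `K`-th smallest eigenvalue, where `K` is the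
number of connected components of the target. -/
def evalGapSet {d : ℕ} (βs : Edge d → ℝ) (s t : ℝ) : Set (Edge d → ℝ) :=
  {β | smallEig (lap (adj (absVec β))) (numComp βs) ≤ s ∧
    t ≤ smallEig (lap (adj (absVec β))) (numComp βs + 1)}

/-- The Laplacian of the residual `|β| - |βs|`. -/
def lapResid {d : ℕ} (β βs : Edge d → ℝ) : Matrix (Fin d) (Fin d) ℝ :=
  lap (adj (absVec β - absVec βs))

end BlockLLA

end

/-!
An LLA step from `β` minimizes `ℓ` plus a weighted `ℓ¹` norm, whose weights
`∑ k, g'(λₖ) ⟪vₖ, eᵢ - eⱼ⟫²` come from the spectral decomposition of the Laplacian of `|β|` and do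
not depend on the choice of the eigenvectors (`isLLAStep_iff`). Suppose that the weights between
different components of the target dominate the gradient of `ℓ` at the Lasso oracle whose weights
are those of the step inside the components. By convexity this oracle is then the unique global
minimizer, that is, the only result of the step (`IsLassoOracle.minimizer_iff`). So everything
reduces to bounds on the weights.

Let `U` be the space of functions that are constant on the components of the target: the kernel of
the target Laplacian. A vector `eᵢ - eⱼ` is orthogonal to `U` inside a component, and its projection
to `U` has squared length at least `2 / maxComp` between components. At the initial point, `g'`
vanishes at all but the `numComp` smallest eigenvalues, and lies between `a₁ τ` and `a₀ τ` at these.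
The weights are therefore comparable to `‖P (eᵢ - eⱼ)‖²` for the corresponding spectral projection
`P`, and Weyl's inequalities and a Davis–Kahan argument (`SpectralPerturbation`) show that `P` is
close to the projection to `U`. This gives upper bounds inside and lower bounds between the
components (`llaWeight_bounds`). For the `ℓ¹` bound, the vectors `eᵢ - eⱼ` inside components are
summed (`sum_blockSupp_sq_le`), which leads to a Hilbert–Schmidt distance of projections; as the
ranks agree, it is computed from the side of `U`, where only the perturbation enters
(`SpectralPerturbation.sum_norm_sub_starProjection_sq_le`). The Euclidean bound follows from the
maximum and `ℓ¹` bounds.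

At a block supported point with well connected blocks, every eigenvector with a small eigenvalue
lies in `U`, so the weights vanish inside the components and stay large between them
(`llaWeight_of_mem_bigEvalCompSet`); the step then returns the block oracle. Since the block oracle
is the Lasso oracle with zero weights, it belongs to the oracle sets, and the same applies to it.
-/

noncomputable section

namespace BlockLLA

/-! ### Dimension counting and subspace perturbation -/

section Perturbation

variable {E ι : Type*} [NormedAddCommGroup E] [InnerProductSpace ℝ E] [Fintype ι]

theorem norm_sum_smul_sq (b : OrthonormalBasis ι ℝ E) (T : Finset ι) (c : ι → ℝ) :
    ‖∑ k ∈ T, c k • b k‖ ^ 2 = ∑ k ∈ T, c k ^ 2 := by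
  rw [← real_inner_self_eq_norm_sq, b.orthonormal.inner_sum]
  simp [sq]

/-- Fewer than `finrank W` linear conditions have a common nonzero solution in `W`. -/
theorem exists_mem_ne_zero_inner_eq_zero [FiniteDimensional ℝ E] (b : OrthonormalBasis ι ℝ E)
    (W : Submodule ℝ E) (T : Finset ι) (h : T.card < Module.finrank ℝ W) :
    ∃ u ∈ W, u ≠ 0 ∧ ∀ k ∈ T, inner ℝ (b k) u = 0 := by
  let f : W →ₗ[ℝ] (T → ℝ) :=
    LinearMap.pi fun k => (innerₛₗ ℝ (b k)).comp W.subtype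
  have hf : LinearMap.ker f ≠ ⊥ := by
    apply LinearMap.ker_ne_bot_of_finrank_lt
    simpa using h
  obtain ⟨u, hu, hu0⟩ := (Submodule.ne_bot_iff _).1 hf
  refine ⟨u, u.2, by simpa using hu0, fun k hk => ?_⟩
  have := congrFun (LinearMap.mem_ker.1 hu) ⟨k, hk⟩
  simpa [f] using this

theorem inner_apply_of_eigen (b : OrthonormalBasis ι ℝ E) {A : E →L[ℝ] E} {μ : ι → ℝ}
    (hb : ∀ k, A (b k) = μ k • b k) (u : E) (k : ι) :
    inner ℝ (b k) (A u) = μ k * inner ℝ (b k) u := by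
  classical
  conv_lhs => rw [← b.sum_repr' u]
  simp only [map_sum, map_smul, hb, inner_sum, inner_smul_right, b.inner_eq_ite]
  rw [Finset.sum_eq_single k]
  · simp; ring
  · intro i _ hi; simp [hi.symm]
  · simp

theorem inner_apply_self_eq_sum (b : OrthonormalBasis ι ℝ E) {A : E →L[ℝ] E} {μ : ι → ℝ}
    (hb : ∀ k, A (b k) = μ k • b k) (u : E) :
    inner ℝ (A u) u = ∑ k, μ k * inner ℝ (b k) u ^ 2 := by
  rw [← b.sum_inner_mul_inner]
  refine Finset.sum_congr rfl fun k _ => ?_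
  rw [real_inner_comm, inner_apply_of_eigen b hb]; ring

theorem norm_apply_sq_eq_sum (b : OrthonormalBasis ι ℝ E) {A : E →L[ℝ] E} {μ : ι → ℝ}
    (hb : ∀ k, A (b k) = μ k • b k) (u : E) :
    ‖A u‖ ^ 2 = ∑ k, μ k ^ 2 * inner ℝ (b k) u ^ 2 := by
  rw [← b.sum_sq_inner_right]
  refine Finset.sum_congr rfl fun k _ => ?_
  rw [inner_apply_of_eigen b hb]; ring

/-- If at most `finrank N` eigenvalues lie below `t > 0` and `A` vanishes on `N`, these eigenvalues
are used up by `N`, so that `A` is bounded below by `t` on `Nᗮ`. -/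
theorem le_inner_apply_self_of_card_le [FiniteDimensional ℝ E] (b : OrthonormalBasis ι ℝ E)
    {A : E →L[ℝ] E} {μ : ι → ℝ}
    (hb : ∀ k, A (b k) = μ k • b k) {N : Submodule ℝ E} (hN : ∀ u ∈ N, A u = 0) {t : ℝ}
    (ht : 0 < t) (hcard : (Finset.univ.filter fun k => μ k < t).card ≤ Module.finrank ℝ N)
    {u : E} (hu : u ∈ Nᗮ) : t * ‖u‖ ^ 2 ≤ inner ℝ (A u) u := by
  by_contra! hlt
  have hu0 : u ≠ 0 := by rintro rfl; simp at hlt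
  have hdisj : Disjoint N (ℝ ∙ u) := by
    refine (Submodule.orthogonal_disjoint N).mono_right ?_
    simpa using hu
  have hrank : Module.finrank ℝ (N ⊔ ℝ ∙ u : Submodule ℝ E) = Module.finrank ℝ N + 1 := by
    have := Submodule.finrank_sup_add_finrank_inf_eq N (ℝ ∙ u)
    rw [hdisj.eq_bot, finrank_bot, finrank_span_singleton hu0] at this
    omega
  -- otherwise `N ⊔ ℝ ∙ u` meets the span of the eigenvectors with eigenvalue at least `t`
  obtain ⟨z, hz, hz0, hzT⟩ := exists_mem_ne_zero_inner_eq_zero b (N ⊔ ℝ ∙ u)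
    (Finset.univ.filter fun k => μ k < t) (by omega)
  have hge : t * ‖z‖ ^ 2 ≤ inner ℝ (A z) z := by
    rw [inner_apply_self_eq_sum b hb, ← b.sum_sq_inner_right, Finset.mul_sum]
    refine Finset.sum_le_sum fun k _ => ?_
    by_cases hk : μ k < t
    · simp [hzT k (by simpa using hk)]
    · gcongr; exact not_lt.1 hk
  obtain ⟨y, hy, v, hv, rfl⟩ := Submodule.mem_sup.1 hz
  obtain ⟨c, rfl⟩ := Submodule.mem_span_singleton.1 hv
  have hyu : inner ℝ y u = 0 := hu y hy
  have hAy : inner ℝ (A u) y = 0 := by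
    have h1 : ∀ k, μ k * inner ℝ (b k) y = 0 := fun k => by
      rw [← inner_apply_of_eigen b hb, hN y hy, inner_zero_right]
    rw [← b.sum_inner_mul_inner]
    refine Finset.sum_eq_zero fun k _ => ?_
    rw [real_inner_comm, inner_apply_of_eigen b hb]
    linear_combination inner ℝ (b k) u * h1 k
  have e1 : inner ℝ (A (y + c • u)) (y + c • u) = c ^ 2 * inner ℝ (A u) u := by
    simp only [map_add, map_smul, hN y hy, zero_add, inner_add_right, inner_smul_left,
      inner_smul_right, hAy]
    simp; ring
  have e2 : ‖y + c • u‖ ^ 2 = ‖y‖ ^ 2 + c ^ 2 * ‖u‖ ^ 2 := by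
    rw [@norm_add_sq_real, inner_smul_right, hyu, norm_smul, mul_pow]
    simp
  rw [e1, e2] at hge
  have hc : c = 0 := by
    by_contra hc
    have : 0 < c ^ 2 := by positivity
    nlinarith [mul_lt_mul_of_pos_left hlt this, sq_nonneg ‖y‖, mul_nonneg ht.le (sq_nonneg ‖y‖)]
  subst hc
  have : ‖y‖ ^ 2 ≤ 0 := by
    have : t * ‖y‖ ^ 2 ≤ 0 := by simpa using hge
    exact le_of_mul_le_mul_left (by simpa using this) ht
  apply hz0
  have : ‖y‖ = 0 := by nlinarith [norm_nonneg y]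
  simp [norm_eq_zero.1 this]

/-- The data of a Davis–Kahan comparison: `A` has eigenvalues `μ` for the orthonormal basis `b`, and
`T` marks its `finrank U` smallest ones; `B` vanishes on `U`, is at least `Δ` on `Uᗮ`, and differs
from `A` by at most `ε * Δ`. -/
structure SpectralPerturbation (A B : E →L[ℝ] E) (b : OrthonormalBasis ι ℝ E) (μ : ι → ℝ)
    (T : Finset ι) (U : Submodule ℝ E) (Δ ε : ℝ) : Prop where
  eigen : ∀ k, A (b k) = μ k • b k
  nonneg : ∀ k, 0 ≤ μ k
  sorted : ∀ k ∈ T, ∀ l ∉ T, μ k ≤ μ l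
  card_eq : T.card = Module.finrank ℝ U
  ker : ∀ u ∈ U, B u = 0
  gap : ∀ u ∈ Uᗮ, Δ * ‖u‖ ^ 2 ≤ inner ℝ (B u) u
  gap_pos : 0 < Δ
  diff : ∀ u, ‖A u - B u‖ ≤ ε * Δ * ‖u‖
  eps_nonneg : 0 ≤ ε
  eps_lt : ε < 1

namespace SpectralPerturbation

variable {A B : E →L[ℝ] E} {b : OrthonormalBasis ι ℝ E} {μ : ι → ℝ} {T : Finset ι}
  {U : Submodule ℝ E} {Δ ε : ℝ}

theorem abs_inner_diff_le (h : SpectralPerturbation A B b μ T U Δ ε) (u : E) :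
    |inner ℝ (A u - B u) u| ≤ ε * Δ * ‖u‖ ^ 2 := by
  calc |inner ℝ (A u - B u) u| ≤ ‖A u - B u‖ * ‖u‖ := abs_real_inner_le_norm _ _
    _ ≤ ε * Δ * ‖u‖ * ‖u‖ := by gcongr; exact h.diff u
    _ = _ := by ring

variable [FiniteDimensional ℝ E]

/-- Weyl's inequality for the small eigenvalues. -/
theorem eigenvalue_le (h : SpectralPerturbation A B b μ T U Δ ε) {k : ι} (hk : k ∈ T) :
    μ k ≤ ε * Δ := by
  classical
  by_contra! hlt
  -- `U` contains a vector whose coordinates along `T` vanish except at `k`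
  obtain ⟨u, hu, hu0, huT⟩ := exists_mem_ne_zero_inner_eq_zero b U (T.erase k) (by
    rw [← h.card_eq]; exact Finset.card_erase_lt_of_mem hk)
  have h1 : μ k * ‖u‖ ^ 2 ≤ inner ℝ (A u) u := by
    rw [inner_apply_self_eq_sum b h.eigen, ← b.sum_sq_inner_right, Finset.mul_sum]
    refine Finset.sum_le_sum fun l _ => ?_
    by_cases hl : l ∈ T.erase k
    · simp [huT l hl]
    · gcongr
      by_cases hlk : l = k
      · rw [hlk]
      · exact h.sorted k hk l (by simpa [hlk] using hl)
  have h2 := (abs_le.1 (h.abs_inner_diff_le u)).2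
  rw [h.ker u hu, sub_zero] at h2
  have h3 : 0 < ‖u‖ := norm_pos_iff.2 hu0
  nlinarith [mul_lt_mul_of_pos_right hlt (pow_pos h3 2)]

/-- Weyl's inequality for the large eigenvalues. -/
theorem le_eigenvalue (h : SpectralPerturbation A B b μ T U Δ ε) {k : ι} (hk : k ∉ T) :
    (1 - ε) * Δ ≤ μ k := by
  classical
  by_contra! hlt
  -- `Uᗮ` contains a vector all of whose coordinates off `T` vanish except at `k`
  have hfin : Module.finrank ℝ U + Module.finrank ℝ Uᗮ = Fintype.card ι := by
    rw [Submodule.finrank_add_finrank_orthogonal, Module.finrank_eq_card_basis b.toBasis]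
  obtain ⟨u, hu, hu0, huT⟩ := exists_mem_ne_zero_inner_eq_zero b Uᗮ (insert k T)ᶜ (by
    have h1 := Finset.card_add_card_compl (insert k T)
    have h2 := Finset.card_insert_of_notMem hk
    have := h.card_eq
    omega)
  have h1 : inner ℝ (A u) u ≤ μ k * ‖u‖ ^ 2 := by
    rw [inner_apply_self_eq_sum b h.eigen, ← b.sum_sq_inner_right, Finset.mul_sum]
    refine Finset.sum_le_sum fun l _ => ?_
    by_cases hl : l ∈ insert k T
    · gcongr
      rcases Finset.mem_insert.1 hl with rfl | hl
      · rfl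
      · exact h.sorted l hl k hk
    · simp [huT l (by simpa using hl)]
  have h2 := (abs_le.1 (h.abs_inner_diff_le u)).1
  rw [inner_sub_left] at h2
  have h3 : 0 < ‖u‖ := norm_pos_iff.2 hu0
  have h4 := h.gap u hu
  nlinarith [mul_lt_mul_of_pos_right hlt (pow_pos h3 2)]

/-- The spectral subspace of the small eigenvalues is almost orthogonal to `Uᗮ`. -/
theorem sum_inner_sq_le_of_mem_orthogonal (h : SpectralPerturbation A B b μ T U Δ ε) {x : E}
    (hx : x ∈ Uᗮ) : ∑ k ∈ T, inner ℝ (b k) x ^ 2 ≤ 4 * ε ^ 2 * ‖x‖ ^ 2 := by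
  classical
  -- `p` is the spectral projection of `x`, and `q` is its part orthogonal to `U`
  set p : E := ∑ k ∈ T, inner ℝ (b k) x • b k with hp
  set q : E := p - U.starProjection p with hq
  have hqU : q ∈ Uᗮ := U.sub_starProjection_mem_orthogonal p
  have hBq : B q = B p := by
    rw [hq, map_sub, h.ker _ (U.starProjection_apply_mem p), sub_zero]
  have hpn : ‖p‖ ^ 2 = ∑ k ∈ T, inner ℝ (b k) x ^ 2 := norm_sum_smul_sq b T _
  have hAp : ‖A p‖ ≤ ε * Δ * ‖p‖ := by
    have h0 : 0 ≤ ε * Δ := mul_nonneg h.eps_nonneg h.gap_pos.le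
    refine le_of_sq_le_sq ?_ (by positivity)
    have : A p = ∑ k ∈ T, (inner ℝ (b k) x * μ k) • b k := by
      simp [hp, h.eigen, smul_smul]
    rw [this, norm_sum_smul_sq, mul_pow, hpn, Finset.mul_sum]
    refine Finset.sum_le_sum fun k hk => ?_
    rw [mul_pow, mul_comm]
    gcongr
    · exact h.nonneg k
    · exact h.eigenvalue_le hk
  have hBp : ‖B p‖ ≤ 2 * ε * Δ * ‖p‖ := by
    have h1 := h.diff p
    have h2 : ‖B p‖ ≤ ‖A p‖ + ‖A p - B p‖ := by
      have := norm_sub_le (A p) (A p - B p)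
      simpa using this
    linarith
  have hqn : ‖q‖ ≤ 2 * ε * ‖p‖ := by
    have h1 := h.gap q hqU
    have h2 : inner ℝ (B q) q ≤ 2 * ε * Δ * ‖p‖ * ‖q‖ := by
      rw [hBq]
      exact (real_inner_le_norm _ _).trans (by gcongr)
    rcases (norm_nonneg q).eq_or_lt with h3 | h3
    · rw [← h3]; have := h.eps_nonneg; positivity
    · refine le_of_mul_le_mul_left ?_ (mul_pos h.gap_pos h3)
      nlinarith
  have hpx : ‖p‖ ^ 2 = inner ℝ q x := by
    have h1 : inner ℝ (U.starProjection p) x = 0 := hx _ (U.starProjection_apply_mem p)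
    rw [hq, inner_sub_left, h1, sub_zero, hpn, hp, sum_inner]
    simp [inner_smul_left, sq]
  have h5 : ‖p‖ ^ 2 ≤ 2 * ε * ‖p‖ * ‖x‖ := by
    rw [hpx]
    exact (real_inner_le_norm _ _).trans (by gcongr)
  have h6 : ‖p‖ ≤ 2 * ε * ‖x‖ := by
    rcases (norm_nonneg p).eq_or_lt with h3 | h3
    · rw [← h3]; have := h.eps_nonneg; positivity
    · refine le_of_mul_le_mul_left ?_ h3
      nlinarith
  rw [← hpn]
  calc ‖p‖ ^ 2 ≤ (2 * ε * ‖x‖) ^ 2 := by gcongr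
    _ = _ := by ring

/-- A vector of `U` has small coordinates along the large eigenvalues of `A`. -/
theorem sum_compl_inner_sq_le [DecidableEq ι] (h : SpectralPerturbation A B b μ T U Δ ε) {u : E}
    (hu : u ∈ U) :
    ((1 - ε) * Δ) ^ 2 * ∑ k ∈ Tᶜ, inner ℝ (b k) u ^ 2 ≤ ‖A u - B u‖ ^ 2 := by
  have h0 : 0 ≤ (1 - ε) * Δ := mul_nonneg (by linarith [h.eps_lt]) h.gap_pos.le
  rw [h.ker u hu, sub_zero, norm_apply_sq_eq_sum b h.eigen, Finset.mul_sum]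
  refine (Finset.sum_le_sum fun k hk => ?_).trans
    (Finset.sum_le_sum_of_subset_of_nonneg (Finset.subset_univ Tᶜ) fun k _ _ => by positivity)
  gcongr
  exact h.le_eigenvalue (by simpa using hk)

/-- A vector `x` whose component along `z ∈ U` is `z` keeps most of its mass in the spectral
subspace of the small eigenvalues. -/
theorem le_sum_inner_sq [DecidableEq ι] (h : SpectralPerturbation A B b μ T U Δ ε) {x z : E}
    (hz : z ∈ U) (hxz : inner ℝ x z = ‖z‖ ^ 2) (hxε : ε * ‖x‖ ≤ (1 - ε) * ‖z‖) :
    ((1 - ε) * ‖z‖ - ε * ‖x‖) ^ 2 ≤ (1 - ε) ^ 2 * ∑ k ∈ T, inner ℝ (b k) x ^ 2 := by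
  have hε : 0 < 1 - ε := by linarith [h.eps_lt]
  have hΔ := h.gap_pos
  have hfar : (1 - ε) ^ 2 * ∑ k ∈ Tᶜ, inner ℝ (b k) z ^ 2 ≤ (ε * ‖z‖) ^ 2 := by
    have h1 := h.sum_compl_inner_sq_le hz
    have h2 : ‖A z - B z‖ ^ 2 ≤ (ε * Δ * ‖z‖) ^ 2 := by gcongr; exact h.diff z
    refine le_of_mul_le_mul_left ?_ (pow_pos hΔ 2)
    nlinarith
  have hx := b.sum_sq_inner_right x
  have hzn := b.sum_sq_inner_right z
  rw [← Finset.sum_add_sum_compl T] at hx hzn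
  have hin : ∑ k ∈ T, inner ℝ (b k) x * inner ℝ (b k) z +
      ∑ k ∈ Tᶜ, inner ℝ (b k) x * inner ℝ (b k) z = ‖z‖ ^ 2 := by
    rw [Finset.sum_add_sum_compl, ← hxz, ← b.sum_inner_mul_inner]
    simp only [real_inner_comm]
  have cs1 := Finset.sum_mul_sq_le_sq_mul_sq T (fun k => inner ℝ (b k) x)
    (fun k => inner ℝ (b k) z)
  have cs2 := Finset.sum_mul_sq_le_sq_mul_sq Tᶜ (fun k => inner ℝ (b k) x)
    (fun k => inner ℝ (b k) z)
  have n1 : 0 ≤ ∑ k ∈ T, inner ℝ (b k) x ^ 2 := Finset.sum_nonneg fun _ _ => sq_nonneg _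
  have n2 : 0 ≤ ∑ k ∈ Tᶜ, inner ℝ (b k) x ^ 2 := Finset.sum_nonneg fun _ _ => sq_nonneg _
  have n3 : 0 ≤ ∑ k ∈ T, inner ℝ (b k) z ^ 2 := Finset.sum_nonneg fun _ _ => sq_nonneg _
  have n4 : 0 ≤ ∑ k ∈ Tᶜ, inner ℝ (b k) z ^ 2 := Finset.sum_nonneg fun _ _ => sq_nonneg _
  set X1 := ∑ k ∈ T, inner ℝ (b k) x ^ 2
  set X2 := ∑ k ∈ Tᶜ, inner ℝ (b k) x ^ 2
  set Z1 := ∑ k ∈ T, inner ℝ (b k) z ^ 2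
  set Z2 := ∑ k ∈ Tᶜ, inner ℝ (b k) z ^ 2
  set I1 := ∑ k ∈ T, inner ℝ (b k) x * inner ℝ (b k) z
  set I2 := ∑ k ∈ Tᶜ, inner ℝ (b k) x * inner ℝ (b k) z
  have hI2 : (1 - ε) * I2 ≤ ε * ‖z‖ * ‖x‖ := by
    refine le_of_sq_le_sq ?_ (by have := h.eps_nonneg; positivity)
    calc ((1 - ε) * I2) ^ 2 ≤ (1 - ε) ^ 2 * (X2 * Z2) := by rw [mul_pow]; gcongr
      _ = X2 * ((1 - ε) ^ 2 * Z2) := by ring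
      _ ≤ ‖x‖ ^ 2 * (ε * ‖z‖) ^ 2 := by gcongr; linarith
      _ = _ := by ring
  -- Cauchy–Schwarz with the test vector `z`, restricted to the coordinates in `T`
  rcases (norm_nonneg z).eq_or_lt with hz0 | hz0
  · rw [← hz0] at hxε ⊢
    have h7 : ε * ‖x‖ = 0 := le_antisymm (by simpa using hxε) (by have := h.eps_nonneg; positivity)
    simp [h7]; positivity
  have hI1 : ‖z‖ * ((1 - ε) * ‖z‖ - ε * ‖x‖) ≤ (1 - ε) * I1 := by nlinarith
  refine le_of_mul_le_mul_left ?_ (pow_pos hz0 2)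
  calc ‖z‖ ^ 2 * ((1 - ε) * ‖z‖ - ε * ‖x‖) ^ 2 = (‖z‖ * ((1 - ε) * ‖z‖ - ε * ‖x‖)) ^ 2 := by ring
    _ ≤ ((1 - ε) * I1) ^ 2 := by
      have : 0 ≤ (1 - ε) * ‖z‖ - ε * ‖x‖ := by linarith
      gcongr
    _ ≤ (1 - ε) ^ 2 * (X1 * Z1) := by rw [mul_pow]; gcongr
    _ ≤ (1 - ε) ^ 2 * (X1 * ‖z‖ ^ 2) := by gcongr; linarith
    _ = _ := by ring

/-- Both sides of the comparison have the same rank, so the Hilbert–Schmidt distance of the spectral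
subspace to `U` can be computed on `U`, where only the perturbation enters. -/
theorem sum_norm_sub_starProjection_sq_le {κ : Type*} [Fintype κ]
    (h : SpectralPerturbation A B b μ T U Δ ε) (u : OrthonormalBasis κ ℝ U) :
    ((1 - ε) * Δ) ^ 2 * ∑ k ∈ T, ‖b k - U.starProjection (b k)‖ ^ 2 ≤
      ∑ j, ‖A (u j) - B (u j)‖ ^ 2 := by
  classical
  have hsq : ∀ k, ‖b k - U.starProjection (b k)‖ ^ 2 = 1 - ∑ j, inner ℝ (b k) (u j : E) ^ 2 := by
    intro k
    have h1 : ∑ j, inner ℝ (b k) (u j : E) ^ 2 = ‖U.starProjection (b k)‖ ^ 2 := by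
      have := u.sum_sq_inner_right (U.orthogonalProjectionOnto (b k))
      rw [Submodule.starProjection_apply, ← Submodule.coe_norm, ← this]
      refine Finset.sum_congr rfl fun j _ => ?_
      rw [real_inner_comm, ← Submodule.inner_orthogonalProjectionOnto_eq_of_mem_left]
    have h2 : ‖b k‖ ^ 2 = ‖U.starProjection (b k)‖ ^ 2 + ‖b k - U.starProjection (b k)‖ ^ 2 := by
      have h3 : inner ℝ (U.starProjection (b k)) (b k - U.starProjection (b k)) = 0 :=
        U.sub_starProjection_mem_orthogonal (b k) _ (U.starProjection_apply_mem _)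
      have := @norm_add_sq_real E _ _ (U.starProjection (b k)) (b k - U.starProjection (b k))
      rw [h3] at this
      simpa using this
    rw [b.norm_eq_one] at h2
    rw [h1]; linarith
  have hswap : ∑ k ∈ T, ‖b k - U.starProjection (b k)‖ ^ 2 =
      ∑ j, ∑ k ∈ Tᶜ, inner ℝ (b k) (u j : E) ^ 2 := by
    have h1 : ∀ j, ∑ k ∈ Tᶜ, inner ℝ (b k) (u j : E) ^ 2 =
        1 - ∑ k ∈ T, inner ℝ (b k) (u j : E) ^ 2 := by
      intro j
      have h2 := b.sum_sq_inner_right (u j : E)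
      rw [← Finset.sum_add_sum_compl T] at h2
      have h3 : ‖(u j : E)‖ = 1 := u.norm_eq_one j
      rw [h3] at h2
      linarith
    have hκ : Fintype.card κ = T.card := by
      rw [h.card_eq, Module.finrank_eq_card_basis u.toBasis]
    simp only [hsq, h1, Finset.sum_sub_distrib]
    rw [Finset.sum_comm]
    simp [hκ]
  rw [hswap, Finset.mul_sum]
  exact Finset.sum_le_sum fun j _ => h.sum_compl_inner_sq_le (u j).2

end SpectralPerturbation

end Perturbation

/-! ### Eigenvalue counting and Laplacians -/

section SmallEig

variable {V : Type*} [Fintype V] [DecidableEq V] {A : Matrix V V ℝ}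

theorem card_filter_eigenvalues (hA : A.IsHermitian) (p : ℝ → Prop) [DecidablePred p] :
    (Finset.univ.filter fun k => p (hA.eigenvalues k)).card =
      (Finset.univ.filter fun i => p (hA.eigenvalues₀ i)).card := by
  refine Finset.card_equiv (Fintype.equivOfCardEq (Fintype.card_fin _)).symm fun k => ?_
  simp only [Finset.mem_filter, Finset.mem_univ, true_and]
  rfl

theorem card_eigenvalues_lt_of_le_smallEig (hA : A.IsHermitian) {j : ℕ}
    (hjV : j + 1 ≤ Fintype.card V) {t : ℝ} (ht : t ≤ smallEig A (j + 1)) :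
    (Finset.univ.filter fun k => hA.eigenvalues k < t).card ≤ j := by
  rw [smallEig, dif_pos ⟨hA, by omega, hjV⟩] at ht
  rw [card_filter_eigenvalues hA (· < t)]
  calc _ ≤ (Finset.Ioi (⟨Fintype.card V - (j + 1), by omega⟩ : Fin (Fintype.card V))).card := by
        refine Finset.card_le_card fun i hi => ?_
        simp only [Finset.mem_filter, Finset.mem_univ, true_and] at hi
        rw [Finset.mem_Ioi]
        by_contra! hle
        exact absurd (ht.trans (hA.eigenvalues₀_antitone hle)) (not_le.2 hi)
    _ ≤ j := by rw [Fin.card_Ioi]; simp only; omega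

theorem le_card_eigenvalues_le_of_smallEig_le (hA : A.IsHermitian) {j : ℕ} (hj : 1 ≤ j)
    (hjV : j ≤ Fintype.card V) {t : ℝ} (ht : smallEig A j ≤ t) :
    j ≤ (Finset.univ.filter fun k => hA.eigenvalues k ≤ t).card := by
  rw [smallEig, dif_pos ⟨hA, hj, hjV⟩] at ht
  rw [card_filter_eigenvalues hA (· ≤ t)]
  calc j ≤ (Finset.Ici (⟨Fintype.card V - j, by omega⟩ : Fin (Fintype.card V))).card := by
        rw [Fin.card_Ici]; simp only; omega
    _ ≤ _ := by
        refine Finset.card_le_card fun i hi => ?_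
        rw [Finset.mem_Ici] at hi
        simp only [Finset.mem_filter, Finset.mem_univ, true_and]
        exact (hA.eigenvalues₀_antitone hi).trans ht

/-- The matrix `A` as an operator on Euclidean space. -/
abbrev euclOp (A : Matrix V V ℝ) : EuclideanSpace ℝ V →L[ℝ] EuclideanSpace ℝ V :=
  Matrix.toEuclideanCLM (n := V) (𝕜 := ℝ) A

theorem euclOp_apply (A : Matrix V V ℝ) (u : EuclideanSpace ℝ V) (i : V) :
    euclOp A u i = ∑ j, A i j * u j := by
  rw [Matrix.ofLp_toEuclideanCLM]; rfl

theorem euclOp_eigenvectorBasis (hA : A.IsHermitian) (k : V) :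
    euclOp A (hA.eigenvectorBasis k) = hA.eigenvalues k • hA.eigenvectorBasis k := by
  ext i
  rw [Matrix.ofLp_toEuclideanCLM, hA.mulVec_eigenvectorBasis]
  rfl

/-- If `A` vanishes on `N`, an eigenvalue bound beyond the first `finrank N` eigenvalues bounds the
quadratic form of `A` on `Nᗮ`. -/
theorem le_inner_euclOp_of_le_smallEig (hA : A.IsHermitian)
    {N : Submodule ℝ (EuclideanSpace ℝ V)} (hN : ∀ u ∈ N, euclOp A u = 0) {t : ℝ} (ht : 0 < t)
    (hNV : Module.finrank ℝ N + 1 ≤ Fintype.card V)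
    (htA : t ≤ smallEig A (Module.finrank ℝ N + 1)) {u : EuclideanSpace ℝ V} (hu : u ∈ Nᗮ) :
    t * ‖u‖ ^ 2 ≤ inner ℝ (euclOp A u) u :=
  le_inner_apply_self_of_card_le hA.eigenvectorBasis (euclOp_eigenvectorBasis hA) hN ht
    (card_eigenvalues_lt_of_le_smallEig hA hNV htA) hu

theorem euclOp_lap_apply (A : Matrix V V ℝ) (u : EuclideanSpace ℝ V) (i : V) :
    euclOp (lap A) u i = ∑ j, A i j * (u i - u j) := by
  rw [euclOp_apply]
  simp only [lap, Matrix.sub_apply, sub_mul, mul_sub, Finset.sum_sub_distrib, Matrix.diagonal_apply]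
  simp [Finset.sum_mul]

theorem inner_euclOp_lap (hA : ∀ i j, A i j = A j i) (u : EuclideanSpace ℝ V) :
    2 * inner ℝ (euclOp (lap A) u) u = ∑ i, ∑ j, A i j * (u i - u j) ^ 2 := by
  have h1 : inner ℝ (euclOp (lap A) u) u = ∑ i, ∑ j, A i j * (u i - u j) * u i := by
    rw [PiLp.inner_apply]
    refine Finset.sum_congr rfl fun i _ => ?_
    rw [euclOp_lap_apply]
    simp [Finset.mul_sum, mul_comm]
  have h2 : inner ℝ (euclOp (lap A) u) u = ∑ i, ∑ j, A i j * (u j - u i) * u j := by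
    rw [h1, Finset.sum_comm]
    exact Finset.sum_congr rfl fun i _ => Finset.sum_congr rfl fun j _ => by rw [hA]
  rw [two_mul]
  nth_rw 1 [h1]
  rw [h2, ← Finset.sum_add_distrib]
  refine Finset.sum_congr rfl fun i _ => ?_
  rw [← Finset.sum_add_distrib]
  exact Finset.sum_congr rfl fun j _ => by ring

theorem inner_euclOp_lap_nonneg (hA : ∀ i j, A i j = A j i) (h0 : ∀ i j, 0 ≤ A i j)
    (u : EuclideanSpace ℝ V) : 0 ≤ inner ℝ (euclOp (lap A) u) u := by
  have := inner_euclOp_lap hA u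
  have h2 : 0 ≤ ∑ i, ∑ j, A i j * (u i - u j) ^ 2 :=
    Finset.sum_nonneg fun i _ => Finset.sum_nonneg fun j _ => mul_nonneg (h0 i j) (sq_nonneg _)
  linarith

theorem eigenvalues_lap_nonneg (hA : ∀ i j, A i j = A j i) (h0 : ∀ i j, 0 ≤ A i j) (k : V) :
    0 ≤ (lap_isHermitian hA).eigenvalues k := by
  have := inner_euclOp_lap_nonneg hA h0 ((lap_isHermitian hA).eigenvectorBasis k)
  rw [euclOp_eigenvectorBasis, inner_smul_left, real_inner_self_eq_norm_sq,
    OrthonormalBasis.norm_eq_one] at this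
  simpa using this

theorem euclOp_lap_eq_zero {u : EuclideanSpace ℝ V} (h : ∀ i j, A i j ≠ 0 → u i = u j) :
    euclOp (lap A) u = 0 := by
  ext i
  rw [euclOp_lap_apply]
  refine Finset.sum_eq_zero fun j _ => ?_
  by_cases hij : A i j = 0
  · simp [hij]
  · simp [h i j hij]

theorem lap_sub (A B : Matrix V V ℝ) : lap (A - B) = lap A - lap B := by
  ext i j
  by_cases h : i = j <;> simp [lap, h] <;> ring

theorem norm_euclOp_le (A : Matrix V V ℝ) (u : EuclideanSpace ℝ V) :
    ‖euclOp A u‖ ≤ opNorm A * ‖u‖ := (euclOp A).le_opNorm u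

theorem opNorm_nonneg (A : Matrix V V ℝ) : 0 ≤ opNorm A := norm_nonneg _

/-- Bessel's inequality for the rows of a matrix. -/
theorem sum_norm_euclOp_sq_le_frobNorm_sq (A : Matrix V V ℝ) {κ : Type*} [Fintype κ]
    {u : κ → EuclideanSpace ℝ V} (hu : Orthonormal ℝ u) :
    ∑ k, ‖euclOp A (u k)‖ ^ 2 ≤ frobNorm A ^ 2 := by
  have hn : 0 ≤ ∑ i, ∑ j, A i j ^ 2 :=
    Finset.sum_nonneg fun _ _ => Finset.sum_nonneg fun _ _ => sq_nonneg _
  rw [frobNorm, Real.sq_sqrt hn]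
  simp only [EuclideanSpace.norm_sq_eq, Real.norm_eq_abs, sq_abs]
  rw [Finset.sum_comm]
  refine Finset.sum_le_sum fun i _ => ?_
  have h := hu.sum_inner_products_le (WithLp.toLp 2 (A i)) (s := Finset.univ)
  rw [EuclideanSpace.norm_sq_eq] at h
  simp only [Real.norm_eq_abs, sq_abs] at h
  refine le_trans (le_of_eq ?_) h
  refine Finset.sum_congr rfl fun k _ => ?_
  rw [euclOp_apply, PiLp.inner_apply]
  simp

theorem sum_norm_euclOp_sq_le_opNorm_sq (A : Matrix V V ℝ) {κ : Type*} [Fintype κ]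
    {u : κ → EuclideanSpace ℝ V} (hu : Orthonormal ℝ u) :
    ∑ k, ‖euclOp A (u k)‖ ^ 2 ≤ Fintype.card κ * opNorm A ^ 2 := by
  calc ∑ k, ‖euclOp A (u k)‖ ^ 2 ≤ ∑ _k : κ, opNorm A ^ 2 := by
        refine Finset.sum_le_sum fun k _ => ?_
        have h := norm_euclOp_le A (u k)
        rw [hu.1 k, mul_one] at h
        gcongr
    _ = _ := by simp

theorem opNorm_le_frobNorm (A : Matrix V V ℝ) : opNorm A ≤ frobNorm A := by
  refine ContinuousLinearMap.opNorm_le_bound _ (Real.sqrt_nonneg _) fun u => ?_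
  by_cases hu : u = 0
  · simp [hu]
  have hn : ‖u‖ ≠ 0 := norm_ne_zero_iff.2 hu
  have ho : Orthonormal ℝ (fun _ : Unit => (‖u‖⁻¹ • u)) := by
    constructor
    · intro; simp [norm_smul, hn]
    · intro i j hij; exact absurd (Subsingleton.elim i j) hij
  have h := sum_norm_euclOp_sq_le_frobNorm_sq A ho
  simp only [Finset.univ_unique, Finset.sum_singleton, map_smul, norm_smul, norm_inv,
    norm_norm] at h
  have h3 := le_of_sq_le_sq h (Real.sqrt_nonneg _)
  rw [inv_mul_le_iff₀ (by positivity)] at h3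
  rwa [mul_comm] at h3

end SmallEig

/-! ### Functions constant on the components of a graph -/

section LocConst

variable {V : Type*} (G : SimpleGraph V)

/-- The subspace of functions on the nodes that are constant on every connected component. -/
def locConst : Submodule ℝ (EuclideanSpace ℝ V) where
  carrier := {u | ∀ i j, G.Reachable i j → u i = u j}
  add_mem' hu hv i j h := by simp [hu i j h, hv i j h]
  zero_mem' i j _ := rfl
  smul_mem' c u hu i j h := by simp [hu i j h]

theorem mem_locConst_of_adj {u : EuclideanSpace ℝ V} (h : ∀ i j, G.Adj i j → u i = u j) :
    u ∈ locConst G := by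
  rintro i j ⟨p⟩
  induction p with
  | nil => rfl
  | cons hadj _ ih => exact (h _ _ hadj).trans ih

theorem finrank_locConst [Fintype V] :
    Module.finrank ℝ (locConst G) = Nat.card G.ConnectedComponent := by
  classical
  let f : (G.ConnectedComponent → ℝ) →ₗ[ℝ] EuclideanSpace ℝ V :=
    { toFun := fun g => WithLp.toLp 2 fun i => g (G.connectedComponentMk i)
      map_add' := fun g h => rfl
      map_smul' := fun c g => rfl }
  have hinj : Function.Injective f := by
    intro g h hgh
    funext c
    induction c using SimpleGraph.ConnectedComponent.ind with
    | h v => exact congrFun (congrArg WithLp.ofLp hgh) v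
  have hrange : LinearMap.range f = locConst G := by
    ext u
    constructor
    · rintro ⟨g, rfl⟩ i j hij
      exact congrArg g (SimpleGraph.ConnectedComponent.eq.2 hij)
    · intro hu
      refine ⟨fun c => u c.out, ?_⟩
      ext i
      exact hu _ _ (SimpleGraph.ConnectedComponent.exact (Quot.out_eq _))
  have : Fintype G.ConnectedComponent := Fintype.ofFinite _
  rw [← hrange, LinearMap.finrank_range_of_inj hinj, Module.finrank_fintype_fun_eq_card,
    Nat.card_eq_fintype_card]

open Classical in
/-- The normalized indicator of a connected component. -/
def compMean (c : G.ConnectedComponent) : EuclideanSpace ℝ V :=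
  WithLp.toLp 2 fun i => if G.connectedComponentMk i = c then ((c.supp.ncard : ℝ))⁻¹ else 0

theorem compMean_mem (c : G.ConnectedComponent) : compMean G c ∈ locConst G := by
  intro i j h
  have hc := SimpleGraph.ConnectedComponent.eq.2 h
  simp only [compMean]
  rw [hc]

variable [Fintype V]

open Classical in
theorem card_filter_mk_eq (c : G.ConnectedComponent) :
    (Finset.univ.filter fun i => G.connectedComponentMk i = c).card = c.supp.ncard := by
  rw [← Set.ncard_coe_finset]
  congr 1
  ext i
  simp

theorem ncard_supp_pos (c : G.ConnectedComponent) : 0 < c.supp.ncard :=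
  (Set.ncard_pos).2 c.nonempty_supp

theorem inner_compMean_self (c : G.ConnectedComponent) :
    inner ℝ (compMean G c) (compMean G c) = ((c.supp.ncard : ℝ))⁻¹ := by
  classical
  have h : ((c.supp.ncard : ℝ)) ≠ 0 := by exact_mod_cast (ncard_supp_pos G c).ne'
  simp only [PiLp.inner_apply, compMean, RCLike.inner_apply, conj_trivial]
  simp only [mul_ite, ite_mul, mul_zero, zero_mul]
  rw [← Finset.sum_filter, Finset.sum_ite_of_true (by simp), Finset.sum_const, card_filter_mk_eq,
    nsmul_eq_mul]
  field_simp

theorem inner_compMean_of_ne {c c' : G.ConnectedComponent} (h : c ≠ c') :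
    inner ℝ (compMean G c) (compMean G c') = 0 := by
  classical
  simp only [PiLp.inner_apply, compMean, RCLike.inner_apply, conj_trivial]
  refine Finset.sum_eq_zero fun i _ => ?_
  by_cases h1 : G.connectedComponentMk i = c
  · have : G.connectedComponentMk i ≠ c' := fun h2 => h (h1.symm.trans h2)
    simp [this]
  · simp [h1]

theorem sum_eq_zero_of_mem_orthogonal {u : EuclideanSpace ℝ V} (hu : u ∈ (locConst G)ᗮ)
    (c : G.ConnectedComponent) [Fintype c.supp] : ∑ i : c.supp, u i = 0 := by
  classical
  have h := hu _ (compMean_mem G c)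
  have hc : ((c.supp.ncard : ℝ)) ≠ 0 := by exact_mod_cast (ncard_supp_pos G c).ne'
  simp only [PiLp.inner_apply, compMean, RCLike.inner_apply, conj_trivial, mul_ite, mul_zero] at h
  rw [← Finset.sum_filter, ← Finset.sum_mul] at h
  rw [← Finset.sum_subtype (Finset.univ.filter fun i => G.connectedComponentMk i = c)
    (p := fun i => i ∈ c.supp) (by simp) (fun i => u i)]
  simpa [hc] using h

end LocConst

/-! ### Edge vectors and the target graph -/

section Edges

variable {d : ℕ}

/-- The vector `eᵢ - eⱼ` of an edge `ij`. -/
def edgeVec (e : Edge d) : EuclideanSpace ℝ (Fin d) :=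
  EuclideanSpace.single e.1.1 1 - EuclideanSpace.single e.1.2 1

theorem inner_edgeVec (e : Edge d) (u : EuclideanSpace ℝ (Fin d)) :
    inner ℝ (edgeVec e) u = u e.1.1 - u e.1.2 := by
  simp [edgeVec, inner_sub_left, EuclideanSpace.inner_single_left]

theorem inner_edgeVec_right (e : Edge d) (u : EuclideanSpace ℝ (Fin d)) :
    inner ℝ u (edgeVec e) = u e.1.1 - u e.1.2 := by
  rw [real_inner_comm, inner_edgeVec]

theorem norm_edgeVec_sq (e : Edge d) : ‖edgeVec e‖ ^ 2 = 2 := by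
  have h := e.2.ne
  rw [← real_inner_self_eq_norm_sq, inner_edgeVec]
  simp [edgeVec, h, h.symm]
  norm_num

theorem two_mul_sum_edge (F : Fin d → Fin d → ℝ) (hF : ∀ i j, F i j = F j i)
    (h0 : ∀ i, F i i = 0) : 2 * ∑ e : Edge d, F e.1.1 e.1.2 = ∑ i, ∑ j, F i j := by
  have h1 : ∑ e : Edge d, F e.1.1 e.1.2 = ∑ i, ∑ j, if i < j then F i j else 0 := by
    rw [← Finset.sum_product', Finset.univ_product_univ, ← Finset.sum_filter]
    exact (Finset.sum_subtype (Finset.univ.filter fun p : Fin d × Fin d => p.1 < p.2)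
      (by simp) (fun p => F p.1 p.2)).symm
  have h2 : ∑ e : Edge d, F e.1.1 e.1.2 = ∑ i, ∑ j, if j < i then F i j else 0 := by
    rw [h1, Finset.sum_comm]
    exact Finset.sum_congr rfl fun i _ => Finset.sum_congr rfl fun j _ => by rw [hF]
  rw [two_mul]
  nth_rw 1 [h1]
  rw [h2, ← Finset.sum_add_distrib]
  refine Finset.sum_congr rfl fun i _ => ?_
  rw [← Finset.sum_add_distrib]
  refine Finset.sum_congr rfl fun j _ => ?_
  rcases lt_trichotomy i j with h | h | h
  · simp [h, h.not_gt]
  · simp [h, h0]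
  · simp [h, h.not_gt]

theorem adj_sub (x y : Edge d → ℝ) : adj (x - y) = adj x - adj y := by
  ext i j
  simp only [adj, Matrix.sub_apply, Pi.sub_apply]
  split_ifs <;> simp

theorem adj_absVec_nonneg (x : Edge d → ℝ) (i j : Fin d) : 0 ≤ adj (absVec x) i j := by
  simp only [adj, absVec]
  split_ifs <;> positivity

theorem adj_absVec_eq_zero_iff (x : Edge d → ℝ) (i j : Fin d) :
    adj (absVec x) i j = 0 ↔ adj x i j = 0 := by
  simp only [adj, absVec]
  split_ifs <;> simp

theorem euclOp_lapResid (β βs : Edge d → ℝ) (u : EuclideanSpace ℝ (Fin d)) :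
    euclOp (lapResid β βs) u =
      euclOp (lap (adj (absVec β))) u - euclOp (lap (adj (absVec βs))) u := by
  rw [lapResid, adj_sub, lap_sub, euclOp, map_sub]
  rfl

variable (βs : Edge d → ℝ)

theorem mem_blockSupp {e : Edge d} :
    e ∈ blockSupp βs ↔ (supportGraph βs).Reachable e.1.1 e.1.2 := by
  simp [blockSupp]

theorem finrank_locConst_supportGraph :
    Module.finrank ℝ (locConst (supportGraph βs)) = numComp βs := finrank_locConst _

theorem ncard_supp_le_maxComp (c : (supportGraph βs).ConnectedComponent) :
    c.supp.ncard ≤ maxComp βs :=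
  le_ciSup (f := fun c : (supportGraph βs).ConnectedComponent => c.supp.ncard)
    (Set.finite_range _).bddAbove c

theorem maxComp_pos (hd : 0 < d) : 0 < maxComp βs :=
  (ncard_supp_pos _ ((supportGraph βs).connectedComponentMk ⟨0, hd⟩)).trans_le
    (ncard_supp_le_maxComp βs _)

theorem numComp_pos (hd : 0 < d) : 0 < numComp βs := by
  have : Nonempty (supportGraph βs).ConnectedComponent :=
    ⟨(supportGraph βs).connectedComponentMk ⟨0, hd⟩⟩
  exact Nat.card_pos

theorem edgeVec_mem_orthogonal {e : Edge d} (he : e ∈ blockSupp βs) :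
    edgeVec e ∈ (locConst (supportGraph βs))ᗮ := by
  intro u hu
  rw [inner_edgeVec_right, hu _ _ ((mem_blockSupp βs).1 he), sub_self]

/-- An edge between two components has a component of squared length at least `2 / maxComp` in the
space of locally constant functions: the difference of the two normalized indicators. -/
theorem exists_mem_locConst_of_notMem_blockSupp {e : Edge d} (he : e ∉ blockSupp βs) :
    ∃ z ∈ locConst (supportGraph βs), inner ℝ (edgeVec e) z = ‖z‖ ^ 2 ∧
      2 / (maxComp βs : ℝ) ≤ ‖z‖ ^ 2 := by
  set G := supportGraph βs
  set c := G.connectedComponentMk e.1.1 with hc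
  set c' := G.connectedComponentMk e.1.2 with hc'
  have hne : c ≠ c' := fun h =>
    he ((mem_blockSupp βs).2 (SimpleGraph.ConnectedComponent.exact h))
  have hn : ‖compMean G c - compMean G c'‖ ^ 2 =
      (c.supp.ncard : ℝ)⁻¹ + (c'.supp.ncard : ℝ)⁻¹ := by
    rw [← real_inner_self_eq_norm_sq, inner_sub_left, inner_sub_right, inner_sub_right,
      inner_compMean_self, inner_compMean_self, inner_compMean_of_ne G hne,
      inner_compMean_of_ne G hne.symm]
    ring
  refine ⟨compMean G c - compMean G c', Submodule.sub_mem _ (compMean_mem G c)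
    (compMean_mem G c'), ?_, ?_⟩
  · rw [hn, inner_edgeVec]
    simp [compMean, ← hc, ← hc', hne, hne.symm]
  · have h1 : ∀ c : G.ConnectedComponent, (maxComp βs : ℝ)⁻¹ ≤ (c.supp.ncard : ℝ)⁻¹ := fun c => by
      have := ncard_supp_pos G c
      have := ncard_supp_le_maxComp βs c
      gcongr
    rw [hn, div_eq_mul_inv, two_mul]
    exact add_le_add (h1 c) (h1 c')

/-- The Laplacian of a disjoint union of complete graphs is at most the largest block size. -/
theorem sum_blockSupp_sq_le (u q : EuclideanSpace ℝ (Fin d))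
    (hq : q ∈ locConst (supportGraph βs)) :
    ∑ e ∈ blockSupp βs, (u e.1.1 - u e.1.2) ^ 2 ≤ maxComp βs * ‖u - q‖ ^ 2 := by
  classical
  set G := supportGraph βs with hG
  set h : Fin d → ℝ := fun i => u i - q i with hh
  have hcomp : ∀ i j, G.Reachable i j ↔ G.connectedComponentMk i = G.connectedComponentMk j :=
    fun i j => SimpleGraph.ConnectedComponent.eq.symm
  let χ : Fin d → Fin d → ℝ := fun i j =>
    if G.connectedComponentMk i = G.connectedComponentMk j then 1 else 0
  have hχs : ∀ i j, χ i j = χ j i := fun i j => by simp only [χ, eq_comm]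
  have e1 : ∑ e ∈ blockSupp βs, (u e.1.1 - u e.1.2) ^ 2 =
      ∑ e : Edge d, χ e.1.1 e.1.2 * (h e.1.1 - h e.1.2) ^ 2 := by
    rw [← Finset.sum_filter_add_sum_filter_not Finset.univ (· ∈ blockSupp βs)]
    rw [Finset.sum_eq_zero (s := Finset.univ.filter fun e => ¬ e ∈ blockSupp βs), add_zero]
    · rw [Finset.filter_mem_eq_inter, Finset.univ_inter]
      refine Finset.sum_congr rfl fun e he => ?_
      have hr := (mem_blockSupp βs).1 he
      simp only [χ, (hcomp _ _).1 hr, if_true, hh, hq _ _ hr]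
      ring
    · intro e he
      have hr := fun hr => (Finset.mem_filter.1 he).2 ((mem_blockSupp βs).2 hr)
      simp only [χ, if_neg (fun h => hr ((hcomp _ _).2 h)), zero_mul]
  have e2 := two_mul_sum_edge (fun i j => χ i j * (h i - h j) ^ 2)
    (fun i j => by rw [hχs]; ring) (fun i => by simp)
  have e3 : ∑ i, ∑ j, χ i j * (h i - h j) ^ 2 =
      2 * ∑ i, (∑ j, χ i j) * h i ^ 2 - 2 * ∑ i, ∑ j, χ i j * (h i * h j) := by
    have e4 : ∑ i, ∑ j, χ i j * h j ^ 2 = ∑ i, (∑ j, χ i j) * h i ^ 2 := by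
      rw [Finset.sum_comm]
      refine Finset.sum_congr rfl fun i _ => ?_
      rw [Finset.sum_mul]
      exact Finset.sum_congr rfl fun j _ => by rw [hχs]
    have e5 : ∑ i, ∑ j, χ i j * h i ^ 2 = ∑ i, (∑ j, χ i j) * h i ^ 2 :=
      Finset.sum_congr rfl fun i _ => by rw [Finset.sum_mul]
    rw [two_mul (∑ i, (∑ j, χ i j) * h i ^ 2)]
    nth_rw 1 [← e5]
    rw [← e4]
    simp only [Finset.mul_sum, ← Finset.sum_add_distrib, ← Finset.sum_sub_distrib]
    exact Finset.sum_congr rfl fun i _ => Finset.sum_congr rfl fun j _ => by ring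
  have e6 : 0 ≤ ∑ i, ∑ j, χ i j * (h i * h j) := by
    have : ∑ i, ∑ j, χ i j * (h i * h j) =
        ∑ c : G.ConnectedComponent, (∑ i, if G.connectedComponentMk i = c then h i else 0) ^ 2 := by
      symm
      simp only [sq, Finset.sum_mul_sum]
      rw [Finset.sum_comm]
      refine Finset.sum_congr rfl fun i _ => ?_
      rw [Finset.sum_comm]
      refine Finset.sum_congr rfl fun j _ => ?_
      rw [Finset.sum_eq_single (G.connectedComponentMk j)]
      · simp [χ]
      · intro c _ hc; simp [hc.symm]
      · simp
    rw [this]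
    exact Finset.sum_nonneg fun _ _ => sq_nonneg _
  have e7 : ∑ i, (∑ j, χ i j) * h i ^ 2 ≤ maxComp βs * ‖u - q‖ ^ 2 := by
    rw [EuclideanSpace.norm_sq_eq, Finset.mul_sum]
    refine Finset.sum_le_sum fun i _ => ?_
    have h1 : ∑ j, χ i j = (G.connectedComponentMk i).supp.ncard := by
      rw [← card_filter_mk_eq]
      simp only [χ, Finset.sum_boole, eq_comm]
    rw [h1]
    have : (((G.connectedComponentMk i).supp.ncard : ℕ) : ℝ) ≤ maxComp βs := by
      exact_mod_cast ncard_supp_le_maxComp βs _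
    simp only [PiLp.sub_apply, Real.norm_eq_abs, sq_abs, hh]
    gcongr
  rw [e1]
  linarith

/-- The Laplacian of `|β|`, as a Hermitian matrix. -/
theorem lap_absVec_isHermitian (β : Edge d → ℝ) : (lap (adj (absVec β))).IsHermitian :=
  lap_isHermitian (adj_symm _)

theorem adj_eq_zero_of_not_reachable {β : Edge d → ℝ} (hβ : ∀ e, e ∉ blockSupp βs → β e = 0)
    {i j : Fin d} (h : ¬ (supportGraph βs).Reachable i j) : adj β i j = 0 := by
  simp only [adj]
  split_ifs with h1 h2
  · exact hβ _ fun h3 => h ((mem_blockSupp βs).1 h3)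
  · exact hβ _ fun h3 => h ((mem_blockSupp βs).1 h3).symm
  · rfl

theorem self_apply_eq_zero_of_notMem_blockSupp {e : Edge d} (he : e ∉ blockSupp βs) :
    βs e = 0 := by
  by_contra h
  refine he ((mem_blockSupp βs).2 (SimpleGraph.Adj.reachable ?_))
  have h1 : adj βs e.1.1 e.1.2 = βs e := by simp [adj, e.2]
  change adj βs e.1.1 e.1.2 ≠ 0
  rwa [h1]

theorem euclOp_lap_eq_zero_of_mem_locConst {β : Edge d → ℝ}
    (hβ : ∀ e, e ∉ blockSupp βs → β e = 0) {u : EuclideanSpace ℝ (Fin d)}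
    (hu : u ∈ locConst (supportGraph βs)) : euclOp (lap (adj (absVec β))) u = 0 := by
  refine euclOp_lap_eq_zero fun i j hij => hu i j ?_
  by_contra h
  exact hij ((adj_absVec_eq_zero_iff β i j).2 (adj_eq_zero_of_not_reachable βs hβ h))

theorem mem_locConst_of_inner_euclOp_lap_nonpos {u : EuclideanSpace ℝ (Fin d)}
    (hu : inner ℝ (euclOp (lap (adj (absVec βs))) u) u ≤ 0) :
    u ∈ locConst (supportGraph βs) := by
  have h1 := inner_euclOp_lap (adj_symm (absVec βs)) u
  have h0 : ∀ i j, 0 ≤ adj (absVec βs) i j * (u i - u j) ^ 2 := fun i j =>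
    mul_nonneg (adj_absVec_nonneg βs i j) (sq_nonneg _)
  have h2 : ∑ i, ∑ j, adj (absVec βs) i j * (u i - u j) ^ 2 = 0 :=
    le_antisymm (by linarith) (Finset.sum_nonneg fun i _ => Finset.sum_nonneg fun j _ => h0 i j)
  refine mem_locConst_of_adj _ fun i j hij => ?_
  have h3 := (Finset.sum_eq_zero_iff_of_nonneg
    (fun i _ => Finset.sum_nonneg fun j _ => h0 i j)).1 h2 i (Finset.mem_univ _)
  have h4 := (Finset.sum_eq_zero_iff_of_nonneg (fun j _ => h0 i j)).1 h3 j (Finset.mem_univ _)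
  rcases mul_eq_zero.1 h4 with h5 | h5
  · exact absurd ((adj_absVec_eq_zero_iff βs i j).1 h5) hij
  · exact sub_eq_zero.1 (pow_eq_zero_iff two_ne_zero |>.1 h5)

/-- The kernel of the target Laplacian consists of the locally constant functions only, so at most
`numComp βs` of its eigenvalues are zero. -/
theorem specGap_pos (hK : numComp βs < d) : 0 < specGap βs := by
  by_contra! hle
  have hA := lap_absVec_isHermitian βs
  set U := locConst (supportGraph βs)
  have hcard := le_card_eigenvalues_le_of_smallEig_le hA (j := numComp βs + 1) (by omega)
    (by simpa using hK) hle
  have hfin : Module.finrank ℝ U + Module.finrank ℝ Uᗮ = d := by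
    rw [Submodule.finrank_add_finrank_orthogonal]; simp
  rw [finrank_locConst_supportGraph] at hfin
  obtain ⟨u, hu, hu0, huT⟩ := exists_mem_ne_zero_inner_eq_zero hA.eigenvectorBasis Uᗮ
    (Finset.univ.filter fun k => hA.eigenvalues k ≤ 0)ᶜ (by
      have h1 := Finset.card_add_card_compl (Finset.univ.filter fun k => hA.eigenvalues k ≤ 0)
      rw [Fintype.card_fin] at h1
      omega)
  have h1 : inner ℝ (euclOp (lap (adj (absVec βs))) u) u ≤ 0 := by
    rw [inner_apply_self_eq_sum hA.eigenvectorBasis (euclOp_eigenvectorBasis hA)]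
    refine Finset.sum_nonpos fun k _ => ?_
    by_cases hk : hA.eigenvalues k ≤ 0
    · exact mul_nonpos_of_nonpos_of_nonneg hk (sq_nonneg _)
    · simp [huT k (by simpa using hk)]
  exact hu0 (inner_self_eq_zero.1 (hu u (mem_locConst_of_inner_euclOp_lap_nonpos βs h1)))

theorem specGap_mul_le (hK : numComp βs < d) {u : EuclideanSpace ℝ (Fin d)}
    (hu : u ∈ (locConst (supportGraph βs))ᗮ) :
    specGap βs * ‖u‖ ^ 2 ≤ inner ℝ (euclOp (lap (adj (absVec βs))) u) u := by
  refine le_inner_euclOp_of_le_smallEig (lap_absVec_isHermitian βs)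
    (fun v hv => euclOp_lap_eq_zero_of_mem_locConst βs
      (fun e he => self_apply_eq_zero_of_notMem_blockSupp βs he) hv)
    (specGap_pos βs hK) ?_ ?_ hu
  · rw [finrank_locConst_supportGraph]; simpa using hK
  · rw [finrank_locConst_supportGraph]; rfl

/-- The Laplacian of a weighted graph is bounded below by its second smallest eigenvalue on
vectors of zero sum. -/
theorem mul_sum_sq_le_of_le_smallEig_two {V : Type*} [Fintype V] [DecidableEq V]
    {A : Matrix V V ℝ} (hA : ∀ i j, A i j = A j i) (hV : 2 ≤ Fintype.card V) {t : ℝ} (ht : 0 < t)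
    (htA : t ≤ smallEig (lap A) 2) {u : V → ℝ} (hu : ∑ i, u i = 0) :
    t * (2 * ∑ i, u i ^ 2) ≤ ∑ i, ∑ j, A i j * (u i - u j) ^ 2 := by
  have : Nonempty V := Fintype.card_pos_iff.1 (by omega)
  set o : EuclideanSpace ℝ V := WithLp.toLp 2 fun _ => 1
  have ho : o ≠ 0 := fun h => by
    have := congrArg (fun x : EuclideanSpace ℝ V => x (Classical.arbitrary V)) h
    simp [o] at this
  have hr := finrank_span_singleton (K := ℝ) ho
  have hz : ∀ v ∈ ℝ ∙ o, euclOp (lap A) v = 0 := by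
    intro v hv
    obtain ⟨c, rfl⟩ := Submodule.mem_span_singleton.1 hv
    exact euclOp_lap_eq_zero fun i j _ => by simp [o]
  have huo : (WithLp.toLp 2 u : EuclideanSpace ℝ V) ∈ (ℝ ∙ o)ᗮ := by
    rw [Submodule.mem_orthogonal_singleton_iff_inner_right]
    simpa [PiLp.inner_apply, o] using hu
  have h := le_inner_euclOp_of_le_smallEig (lap_isHermitian hA) hz ht (by rw [hr]; exact hV)
    (by rw [hr]; exact htA) huo
  have h2 := inner_euclOp_lap hA (WithLp.toLp 2 u)
  rw [EuclideanSpace.norm_sq_eq] at h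
  simp only [Real.norm_eq_abs, sq_abs] at h
  linarith

/-- Lower bounds on the second eigenvalues of the blocks combine to a lower bound orthogonally to
the locally constant functions. -/
theorem mul_norm_sq_le_of_mem_bigEvalCompSet {β : Edge d → ℝ}
    {t : ℝ} (ht : 0 < t) (hmem : β ∈ bigEvalCompSet βs t) {u : EuclideanSpace ℝ (Fin d)}
    (hu : u ∈ (locConst (supportGraph βs))ᗮ) :
    t * ‖u‖ ^ 2 ≤ inner ℝ (euclOp (lap (adj (absVec β))) u) u := by
  classical
  set G := supportGraph βs
  have hsplit : ∀ f : Fin d → ℝ, ∑ i, f i = ∑ c : G.ConnectedComponent, ∑ i : c.supp, f i := by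
    intro f
    rw [← Finset.sum_fiberwise Finset.univ G.connectedComponentMk]
    refine Finset.sum_congr rfl fun c _ => ?_
    exact Finset.sum_subtype _ (by simp) _
  set A := adj (absVec β)
  have h0 : ∀ i j, 0 ≤ A i j * (u i - u j) ^ 2 := fun i j =>
    mul_nonneg (adj_absVec_nonneg β i j) (sq_nonneg _)
  have hc : ∀ c : G.ConnectedComponent, t * (2 * ∑ i : c.supp, u i ^ 2) ≤
      ∑ i : c.supp, ∑ j : c.supp, A i j * (u i - u j) ^ 2 := by
    intro c
    have hs := sum_eq_zero_of_mem_orthogonal G hu c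
    have hcard : Fintype.card c.supp = c.supp.ncard := by
      rw [← Nat.card_eq_fintype_card]; rfl
    rcases Nat.lt_or_ge c.supp.ncard 2 with h2 | h2
    · have h1 : Fintype.card c.supp ≤ 1 := by omega
      have hsub := Fintype.card_le_one_iff_subsingleton.1 h1
      have hz : ∀ i : c.supp, u i = 0 := fun i => by
        rw [← hs, Fintype.sum_subsingleton _ i]
      simp [hz]
    · have hm := hmem c h2
      refine mul_sum_sq_le_of_le_smallEig_two (A := fun i j : c.supp => A i j)
        (fun i j => adj_symm _ _ _) (by omega) ht ?_ hs
      convert hm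
  have h1 := inner_euclOp_lap (adj_symm (absVec β)) u
  have h2 : ∑ c : G.ConnectedComponent, ∑ i : c.supp, ∑ j : c.supp, A i j * (u i - u j) ^ 2 ≤
      ∑ i, ∑ j, A i j * (u i - u j) ^ 2 := by
    rw [hsplit fun i => ∑ j, A i j * (u i - u j) ^ 2]
    refine Finset.sum_le_sum fun c _ => Finset.sum_le_sum fun i _ => ?_
    rw [hsplit]
    exact Finset.single_le_sum (f := fun c : G.ConnectedComponent =>
      ∑ j : c.supp, A i j * (u i - u j) ^ 2)
      (fun c _ => Finset.sum_nonneg fun j _ => h0 _ _) (Finset.mem_univ c)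
  have h3 : t * (2 * ‖u‖ ^ 2) ≤ ∑ c : G.ConnectedComponent, ∑ i : c.supp, ∑ j : c.supp,
      A i j * (u i - u j) ^ 2 := by
    rw [EuclideanSpace.norm_sq_eq]
    simp only [Real.norm_eq_abs, sq_abs]
    rw [hsplit fun i => u i ^ 2, Finset.mul_sum, Finset.mul_sum]
    exact Finset.sum_le_sum fun c _ => hc c
  linarith

end Edges

/-! ### Penalty derivatives and LLA weights -/

section Penalty

variable {a₀ a₁ b₁ b₂ τ : ℝ} {g : ℝ → ℝ}

theorem IsScadLike.penDeriv_nonneg (hg : IsScadLike a₀ a₁ b₁ b₂ τ g) (hτ : 0 ≤ τ) (t : ℝ) :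
    0 ≤ penDeriv a₀ τ g t := by
  rw [penDeriv]
  split_ifs with ht
  · rw [← derivWithin_of_mem_nhds (Ici_mem_nhds ht)]
    exact hg.mono.derivWithin_nonneg
  · exact mul_nonneg (hg.a₁_pos.le.trans hg.a₁_le) hτ

theorem IsScadLike.penDeriv_le (hg : IsScadLike a₀ a₁ b₁ b₂ τ g) (t : ℝ) :
    penDeriv a₀ τ g t ≤ a₀ * τ := by
  rw [penDeriv]
  split_ifs with ht
  · have hconc : ConcaveOn ℝ (Ioi 0) g := hg.concave.subset Ioi_subset_Ici_self (convex_Ioi 0)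
    have hanti : AntitoneOn (deriv g) (Ioi 0) :=
      hconc.antitoneOn_deriv fun s hs => hg.diff s hs
    refine ge_of_tendsto hg.deriv_zero ?_
    filter_upwards [Ioo_mem_nhdsGT ht] with s hs
    exact hanti hs.1 ht hs.2.le
  · exact le_rfl

theorem IsScadLike.le_penDeriv (hg : IsScadLike a₀ a₁ b₁ b₂ τ g) (hτ : 0 ≤ τ) {t : ℝ}
    (ht : t ≤ b₁ * τ) : a₁ * τ ≤ penDeriv a₀ τ g t := by
  by_cases h : 0 < t
  · exact hg.deriv_ge t h ht
  · rw [penDeriv, if_neg h]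
    exact mul_le_mul_of_nonneg_right hg.a₁_le hτ

end Penalty

section Weights

variable {d : ℕ}

/-- If `V` and `W` both diagonalize `L`, then `f(L)` can be computed from either of them. -/
theorem mul_diagonal_mul_transpose_eq {n : Type*} [Fintype n] [DecidableEq n]
    {L V W : Matrix n n ℝ} {μ ν : n → ℝ} (hV : V ∈ Matrix.orthogonalGroup n ℝ)
    (hW : W ∈ Matrix.orthogonalGroup n ℝ) (hLV : L * V = V * Matrix.diagonal μ)
    (hLW : L * W = W * Matrix.diagonal ν) (f : ℝ → ℝ) :
    V * Matrix.diagonal (fun k => f (μ k)) * V.transpose =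
      W * Matrix.diagonal (fun k => f (ν k)) * W.transpose := by
  have hV1 : V.transpose * V = 1 := (Matrix.mem_orthogonalGroup_iff' n ℝ).1 hV
  have hV2 : V * V.transpose = 1 := (Matrix.mem_orthogonalGroup_iff n ℝ).1 hV
  have hW2 : W * W.transpose = 1 := (Matrix.mem_orthogonalGroup_iff n ℝ).1 hW
  have hVL : V.transpose * L = Matrix.diagonal μ * V.transpose := by
    calc V.transpose * L = V.transpose * (L * V) * V.transpose := by
          rw [Matrix.mul_assoc, Matrix.mul_assoc, hV2, Matrix.mul_one]
      _ = V.transpose * V * Matrix.diagonal μ * V.transpose := by rw [hLV, Matrix.mul_assoc _ V]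
      _ = _ := by rw [hV1, Matrix.one_mul]
  set Q := V.transpose * W with hQ
  have hcomm : Matrix.diagonal μ * Q = Q * Matrix.diagonal ν := by
    rw [hQ, ← Matrix.mul_assoc, ← hVL, Matrix.mul_assoc, hLW, Matrix.mul_assoc]
  have hcommf : Matrix.diagonal (fun k => f (μ k)) * Q = Q * Matrix.diagonal fun k => f (ν k) := by
    ext i j
    have h := congrFun (congrFun hcomm i) j
    rw [Matrix.diagonal_mul, Matrix.mul_diagonal] at h ⊢
    by_cases h0 : Q i j = 0
    · simp [h0]
    · have : μ i = ν j := mul_right_cancel₀ h0 (h.trans (mul_comm _ _))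
      rw [this, mul_comm]
  have hVQ : V.transpose = Q * W.transpose := by
    rw [hQ, Matrix.mul_assoc, hW2, Matrix.mul_one]
  have hWQ : W = V * Q := by rw [hQ, ← Matrix.mul_assoc, hV2, Matrix.one_mul]
  calc V * Matrix.diagonal (fun k => f (μ k)) * V.transpose
      = V * (Matrix.diagonal (fun k => f (μ k)) * Q) * W.transpose := by
        conv_lhs => rw [hVQ]
        simp only [Matrix.mul_assoc]
    _ = V * Q * Matrix.diagonal (fun k => f (ν k)) * W.transpose := by
        rw [hcommf]; simp only [Matrix.mul_assoc]
    _ = _ := by rw [← hWQ]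

theorem lapCoeff_eq (V : Matrix (Fin d) (Fin d) ℝ) (w : Fin d → ℝ) (e : Edge d) :
    lapCoeff V w e =
      (V * Matrix.diagonal w * V.transpose) e.1.1 e.1.1 -
      (V * Matrix.diagonal w * V.transpose) e.1.1 e.1.2 -
      (V * Matrix.diagonal w * V.transpose) e.1.2 e.1.1 +
      (V * Matrix.diagonal w * V.transpose) e.1.2 e.1.2 := by
  simp only [lapCoeff, Matrix.mul_apply (M := V * Matrix.diagonal w), Matrix.mul_diagonal,
    Matrix.transpose_apply, ← Finset.sum_sub_distrib, ← Finset.sum_add_distrib]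
  exact Finset.sum_congr rfl fun k _ => by ring

/-- The Lasso weights of an LLA step from `β`, computed from Mathlib's eigenbasis of the Laplacian
of `|β|`. -/
def llaWeight (a₀ τ : ℝ) (g : ℝ → ℝ) (β : Edge d → ℝ) (e : Edge d) : ℝ :=
  ∑ k, penDeriv a₀ τ g ((lap_absVec_isHermitian β).eigenvalues k) *
    inner ℝ ((lap_absVec_isHermitian β).eigenvectorBasis k) (edgeVec e) ^ 2

/-- The weights of an LLA step do not depend on the choice of the eigenvectors. -/
theorem isLLAStep_iff {ℓ : (Edge d → ℝ) → ℝ} {a₀ τ : ℝ} {g : ℝ → ℝ} {β β' : Edge d → ℝ} :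
    IsLLAStep ℓ a₀ τ g β β' ↔ ∀ b : Edge d → ℝ,
      ℓ β' + 1 / 2 * ∑ e, |β' e| * llaWeight a₀ τ g β e ≤
        ℓ b + 1 / 2 * ∑ e, |b e| * llaWeight a₀ τ g β e := by
  set hA := lap_absVec_isHermitian β with hhA
  set W : Matrix (Fin d) (Fin d) ℝ := hA.eigenvectorUnitary.1 with hW
  have hWo : W ∈ Matrix.orthogonalGroup (Fin d) ℝ := hA.eigenvectorUnitary.2
  have hLW : lap (adj (absVec β)) * W = W * Matrix.diagonal hA.eigenvalues := by
    ext i k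
    have h := congrFun (hA.mulVec_eigenvectorBasis k) i
    rw [Matrix.mul_diagonal, Matrix.mul_apply]
    simpa [hW, Matrix.mulVec, dotProduct, mul_comm] using h
  have hWc : lapCoeff W (fun k => penDeriv a₀ τ g (hA.eigenvalues k)) = llaWeight a₀ τ g β := by
    funext e
    simp only [lapCoeff, llaWeight, inner_edgeVec_right]
    rfl
  constructor
  · rintro ⟨V, μ, hV, hLV, hmin⟩
    have : lapCoeff V (fun k => penDeriv a₀ τ g (μ k)) = llaWeight a₀ τ g β := by
      rw [← hWc]
      funext e
      rw [lapCoeff_eq, lapCoeff_eq, mul_diagonal_mul_transpose_eq hV hWo hLV hLW]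
    rwa [this] at hmin
  · intro h
    exact ⟨W, hA.eigenvalues, hWo, hLW, by rwa [hWc]⟩

theorem llaWeight_nonneg {a₀ a₁ b₁ b₂ τ : ℝ} {g : ℝ → ℝ} (hg : IsScadLike a₀ a₁ b₁ b₂ τ g)
    (hτ : 0 ≤ τ) (β : Edge d → ℝ) (e : Edge d) : 0 ≤ llaWeight a₀ τ g β e :=
  Finset.sum_nonneg fun _ _ => mul_nonneg (hg.penDeriv_nonneg hτ _) (sq_nonneg _)

end Weights

/-! ### Oracle solutions as global minimizers -/

section Certificate

theorem tendsto_slope_fderiv {E : Type*} [NormedAddCommGroup E] [NormedSpace ℝ E] {ℓ : E → ℝ}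
    {β : E} (hd : DifferentiableAt ℝ ℓ β) (h : E) :
    Tendsto (fun t : ℝ => t⁻¹ * (ℓ (β + t • h) - ℓ β)) (𝓝[>] 0) (𝓝 (fderiv ℝ ℓ β h)) := by
  simpa using (hd.hasFDerivAt.hasLineDerivAt h).tendsto_slope_zero_right

theorem convex_fderiv_le {E : Type*} [NormedAddCommGroup E] [NormedSpace ℝ E] {ℓ : E → ℝ}
    (hℓ : ConvexOn ℝ univ ℓ) {β : E} (hd : DifferentiableAt ℝ ℓ β) (h : E) :
    fderiv ℝ ℓ β h ≤ ℓ (β + h) - ℓ β := by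
  refine le_of_tendsto (tendsto_slope_fderiv hd h) ?_
  filter_upwards [Ioo_mem_nhdsGT (zero_lt_one' ℝ)] with t ht
  have h1 := hℓ.2 (mem_univ β) (mem_univ (β + h)) (sub_nonneg.2 ht.2.le) ht.1.le (by ring)
  have h2 : (1 - t) • β + t • (β + h) = β + t • h := by
    rw [sub_smul, smul_add, one_smul]; abel
  rw [h2, smul_eq_mul, smul_eq_mul] at h1
  rw [inv_mul_le_iff₀ ht.1]
  linarith

variable {d : ℕ} {ℓ : (Edge d → ℝ) → ℝ} {βs : Edge d → ℝ}

theorem fderiv_apply_eq_sum (β h : Edge d → ℝ) :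
    fderiv ℝ ℓ β h = ∑ e, h e * fderiv ℝ ℓ β (Pi.single e 1) := by
  conv_lhs => rw [pi_eq_sum_univ' h]
  rw [map_sum]
  refine Finset.sum_congr rfl fun e _ => ?_
  rw [map_smul, smul_eq_mul]

/-- The first order condition of the Lasso oracle problem along block supported directions. -/
theorem IsLassoOracle.fderiv_add_nonneg {w β b : Edge d → ℝ} (hβ : IsLassoOracle ℓ βs w β)
    (hw : IsWeight βs w) (hd : DifferentiableAt ℝ ℓ β) (hb : ∀ e, e ∉ blockSupp βs → b e = 0) :
    0 ≤ fderiv ℝ ℓ β (b - β) + 1 / 2 * ∑ e ∈ blockSupp βs, w e * (|b e| - |β e|) := by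
  refine ge_of_tendsto ((tendsto_slope_fderiv hd (b - β)).add_const _) ?_
  filter_upwards [Ioo_mem_nhdsGT (zero_lt_one' ℝ)] with t ht
  have h1 := hβ.2 (β + t • (b - β)) (fun e he => by simp [hβ.1 e he, hb e he])
  have h2 : ∑ e ∈ blockSupp βs, w e * |(β + t • (b - β)) e| ≤
      ∑ e ∈ blockSupp βs, w e * |β e| + t * ∑ e ∈ blockSupp βs, w e * (|b e| - |β e|) := by
    rw [Finset.mul_sum, ← Finset.sum_add_distrib]
    refine Finset.sum_le_sum fun e _ => ?_
    have h3 : |(β + t • (b - β)) e| ≤ (1 - t) * |β e| + t * |b e| := by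
      have : (β + t • (b - β)) e = (1 - t) * β e + t * b e := by
        simp only [Pi.add_apply, Pi.smul_apply, Pi.sub_apply, smul_eq_mul]; ring
      rw [this]
      refine (abs_add_le _ _).trans ?_
      rw [abs_mul, abs_mul, abs_of_pos ht.1, abs_of_pos (sub_pos.2 ht.2)]
    nlinarith [mul_le_mul_of_nonneg_left h3 (hw.1 e)]
  have h4 : 0 ≤ t * (t⁻¹ * (ℓ (β + t • (b - β)) - ℓ β) +
      1 / 2 * ∑ e ∈ blockSupp βs, w e * (|b e| - |β e|)) := by
    rw [mul_add, mul_inv_cancel_left₀ ht.1.ne']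
    linarith
  exact nonneg_of_mul_nonneg_right h4 ht.1

/-- A Lasso oracle solution whose gradient off the block support is dominated by the weights there
is the unique global minimizer of the weighted Lasso problem. -/
theorem IsLassoOracle.minimizer_iff {w M β β' : Edge d → ℝ} {t : ℝ} (hℓ : ConvexOn ℝ univ ℓ)
    (hβ : IsLassoOracle ℓ βs w β) (huniq : ∀ b, IsLassoOracle ℓ βs w b → b = β)
    (hw : IsWeight βs w) (hnice : β ∈ niceGradSet ℓ βs t)
    (hMw : ∀ e ∈ blockSupp βs, M e = w e) (hM : ∀ e, e ∉ blockSupp βs → t ≤ 1 / 2 * M e) :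
    (∀ b : Edge d → ℝ, ℓ β' + 1 / 2 * ∑ e, |β' e| * M e ≤ ℓ b + 1 / 2 * ∑ e, |b e| * M e) ↔
      β' = β := by
  obtain ⟨hd, hgrad⟩ := hnice
  set S := blockSupp βs with hS
  set D : Edge d → ℝ := fun e => fderiv ℝ ℓ β (Pi.single e 1) with hD
  have hsum : ∀ x : Edge d → ℝ, ∑ e, |x e| * M e =
      ∑ e ∈ S, w e * |x e| + ∑ e ∈ Sᶜ, |x e| * M e := by
    intro x
    rw [← Finset.sum_add_sum_compl S]
    congr 1
    exact Finset.sum_congr rfl fun e he => by rw [hMw e he, mul_comm]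
  have hβ0 : ∑ e ∈ Sᶜ, |β e| * M e = 0 :=
    Finset.sum_eq_zero fun e he => by simp [hβ.1 e (by simpa using he)]
  -- the objective exceeds its value at `β` by the slack of the gradient bounds
  have key : ∀ b : Edge d → ℝ,
      ℓ β + 1 / 2 * ∑ e, |β e| * M e + ∑ e ∈ Sᶜ, (1 / 2 * M e - |D e|) * |b e| ≤
        ℓ b + 1 / 2 * ∑ e, |b e| * M e := by
    intro b
    have h1 := convex_fderiv_le hℓ hd (b - β)
    rw [add_sub_cancel] at h1
    set bS : Edge d → ℝ := fun e => if e ∈ S then b e else 0 with hbS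
    have h2 := hβ.fderiv_add_nonneg hw hd (b := bS) (fun e he => by simp [hbS, hS, he])
    have h3 : fderiv ℝ ℓ β (b - β) = fderiv ℝ ℓ β (bS - β) + ∑ e ∈ Sᶜ, b e * D e := by
      have h4 : b - β = (bS - β) + (b - bS) := by abel
      rw [h4, map_add, fderiv_apply_eq_sum β (b - bS), ← Finset.sum_add_sum_compl S]
      rw [Finset.sum_eq_zero (s := S) (fun e he => by simp [hbS, he]), zero_add]
      congr 1
      exact Finset.sum_congr rfl fun e he => by
        have : e ∉ S := by simpa using he
        simp [hbS, hD, this]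
    have h5 : ∑ e ∈ S, w e * (|bS e| - |β e|) = ∑ e ∈ S, w e * |b e| - ∑ e ∈ S, w e * |β e| := by
      rw [← Finset.sum_sub_distrib]
      exact Finset.sum_congr rfl fun e he => by simp [hbS, he, mul_sub]
    have h6 : ∑ e ∈ Sᶜ, (1 / 2 * M e - |D e|) * |b e| ≤
        ∑ e ∈ Sᶜ, b e * D e + 1 / 2 * ∑ e ∈ Sᶜ, |b e| * M e := by
      rw [Finset.mul_sum, ← Finset.sum_add_distrib]
      refine Finset.sum_le_sum fun e _ => ?_
      have := neg_abs_le (b e * D e)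
      rw [abs_mul] at this
      linarith
    rw [h5] at h2
    rw [hsum, hsum, hβ0]
    linarith
  have hslack : ∀ e ∈ Sᶜ, 0 < 1 / 2 * M e - |D e| := fun e he => by
    have he' : e ∉ S := by simpa using he
    have h1 := hgrad e he'
    have h2 := hM e he'
    simp only [hD]
    linarith
  constructor
  · intro hmin
    have h1 := key β'
    have h2 := hmin β
    have h0 : ∀ e ∈ Sᶜ, 0 ≤ (1 / 2 * M e - |D e|) * |β' e| := fun e he =>
      mul_nonneg (hslack e he).le (abs_nonneg _)
    have h3 : ∑ e ∈ Sᶜ, (1 / 2 * M e - |D e|) * |β' e| = 0 :=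
      le_antisymm (by linarith) (Finset.sum_nonneg h0)
    have hsupp : ∀ e, e ∉ S → β' e = 0 := fun e he => by
      have he' : e ∈ Sᶜ := by simpa using he
      have h4 := (Finset.sum_eq_zero_iff_of_nonneg h0).1 h3 e he'
      exact abs_eq_zero.1 ((mul_eq_zero.1 h4).resolve_left (hslack e he').ne')
    refine huniq β' ⟨hsupp, fun b hb => ?_⟩
    have h5 : ∀ x : Edge d → ℝ, (∀ e, e ∉ S → x e = 0) → ∑ e ∈ Sᶜ, |x e| * M e = 0 :=
      fun x hx => Finset.sum_eq_zero fun e he => by simp [hx e (by simpa using he)]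
    have h6 := hmin b
    rw [hsum, hsum, h5 _ hsupp, h5 _ hb, add_zero, add_zero] at h6
    exact h6
  · rintro rfl b
    refine le_trans ?_ (key b)
    have : 0 ≤ ∑ e ∈ Sᶜ, (1 / 2 * M e - |D e|) * |b e| :=
      Finset.sum_nonneg fun e he => mul_nonneg (hslack e he).le (abs_nonneg _)
    linarith

end Certificate

/-! ### Weights of the LLA steps -/

section Steps

variable {d : ℕ} {ℓ : (Edge d → ℝ) → ℝ} {βs β₀ β : Edge d → ℝ} {g : ℝ → ℝ}
  {a₀ a₁ b₁ b₂ τ ρ : ℝ}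

theorem IsScadLike.penDeriv_eq_zero_of_tau (hg : IsScadLike a₀ a₁ b₁ b₂ 0 g) (t : ℝ) :
    penDeriv a₀ 0 g t = 0 :=
  le_antisymm (by simpa using hg.penDeriv_le t) (hg.penDeriv_nonneg le_rfl t)

theorem llaWeight_eq_zero_of_tau (hg : IsScadLike a₀ a₁ b₁ b₂ 0 g) (β : Edge d → ℝ) (e : Edge d) :
    llaWeight a₀ 0 g β e = 0 := by
  simp [llaWeight, hg.penDeriv_eq_zero_of_tau]

/-- At an initial point with an eigengap, the weights of the LLA step are governed by the spectral
projection on the `numComp βs` smallest eigenvalues, which is close to the target projection. -/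
theorem exists_spectralPerturbation (hτ : 0 < τ) (hg : IsScadLike a₀ a₁ b₁ b₂ τ g)
    (hK : numComp βs < d) (hgap : β₀ ∈ evalGapSet βs (b₁ * τ) (b₂ * τ))
    (hε : opNorm (lapResid β₀ βs) / specGap βs < 1) :
    ∃ T : Finset (Fin d),
      SpectralPerturbation (euclOp (lap (adj (absVec β₀)))) (euclOp (lap (adj (absVec βs))))
        (lap_absVec_isHermitian β₀).eigenvectorBasis (lap_absVec_isHermitian β₀).eigenvalues T
        (locConst (supportGraph βs)) (specGap βs) (opNorm (lapResid β₀ βs) / specGap βs) ∧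
      ∀ e, a₁ * τ * ∑ k ∈ T,
          inner ℝ ((lap_absVec_isHermitian β₀).eigenvectorBasis k) (edgeVec e) ^ 2 ≤
            llaWeight a₀ τ g β₀ e ∧
        llaWeight a₀ τ g β₀ e ≤ a₀ * τ * ∑ k ∈ T,
          inner ℝ ((lap_absVec_isHermitian β₀).eigenvectorBasis k) (edgeVec e) ^ 2 := by
  set hA := lap_absVec_isHermitian β₀
  have hd : 0 < d := by omega
  have hb : b₁ * τ < b₂ * τ := mul_lt_mul_of_pos_right hg.b₁_lt hτ
  have h1 := le_card_eigenvalues_le_of_smallEig_le hA (numComp_pos βs hd) (by simp; omega) hgap.1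
  have h2 := card_eigenvalues_lt_of_le_smallEig hA (by simpa using hK) hgap.2
  have hsub : (Finset.univ.filter fun k => hA.eigenvalues k ≤ b₁ * τ) ⊆
      Finset.univ.filter fun k => hA.eigenvalues k < b₂ * τ :=
    Finset.monotone_filter_right _ fun k _ hk => lt_of_le_of_lt hk hb
  have heq := Finset.eq_of_subset_of_card_le hsub (h2.trans h1)
  set T := Finset.univ.filter fun k => hA.eigenvalues k ≤ b₁ * τ with hT
  have hTin : ∀ k ∈ T, hA.eigenvalues k ≤ b₁ * τ := fun k hk => by simpa [hT] using hk
  have hTout : ∀ k ∉ T, b₂ * τ ≤ hA.eigenvalues k := fun k hk => by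
    rw [heq] at hk; simpa using hk
  have hΔ := specGap_pos βs hK
  refine ⟨T, ⟨euclOp_eigenvectorBasis hA,
    eigenvalues_lap_nonneg (adj_symm _) (adj_absVec_nonneg β₀),
    fun k hk l hl => (hTin k hk).trans (hb.le.trans (hTout l hl)), ?_,
    fun u hu => euclOp_lap_eq_zero_of_mem_locConst βs
      (fun e he => self_apply_eq_zero_of_notMem_blockSupp βs he) hu,
    fun u hu => specGap_mul_le βs hK hu, hΔ, ?_, div_nonneg (opNorm_nonneg _) hΔ.le, hε⟩, ?_⟩
  · rw [finrank_locConst_supportGraph]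
    exact le_antisymm ((Finset.card_le_card hsub).trans h2) h1
  · intro u
    rw [← euclOp_lapResid, div_mul_cancel₀ _ hΔ.ne']
    exact norm_euclOp_le _ u
  · intro e
    have hw : llaWeight a₀ τ g β₀ e = ∑ k ∈ T, penDeriv a₀ τ g (hA.eigenvalues k) *
        inner ℝ (hA.eigenvectorBasis k) (edgeVec e) ^ 2 := by
      symm
      refine Finset.sum_subset (Finset.subset_univ _) fun k _ hk => ?_
      rw [hg.deriv_flat _ (hTout k hk), zero_mul]
    rw [hw, Finset.mul_sum, Finset.mul_sum]
    constructor
    · refine Finset.sum_le_sum fun k hk => ?_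
      gcongr
      exact hg.le_penDeriv hτ.le (hTin k hk)
    · refine Finset.sum_le_sum fun k hk => ?_
      gcongr
      exact hg.penDeriv_le _

/-- The relative perturbation is at most `1 / 64` of the inverse square root of the block size. -/
theorem eps_sq_mul_le {ε m : ℝ} (ha₁ : 0 < a₁) (ha : a₁ ≤ a₀) (hm : 0 < m) (hε0 : 0 ≤ ε)
    (hε : ε ≤ 1 / 2 ^ 6 * Real.sqrt (a₁ / (a₀ * m))) : (64 * ε) ^ 2 * m ≤ 1 := by
  have ha₀ : 0 < a₀ := ha₁.trans_le ha
  have h1 : 64 * ε ≤ Real.sqrt (a₁ / (a₀ * m)) := by linarith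
  have h2 : (64 * ε) ^ 2 ≤ a₁ / (a₀ * m) := by
    rw [← Real.sq_sqrt (show 0 ≤ a₁ / (a₀ * m) by positivity)]
    gcongr
  calc (64 * ε) ^ 2 * m ≤ a₁ / (a₀ * m) * m := by gcongr
    _ = a₁ / a₀ := by field_simp
    _ ≤ 1 := by rw [div_le_one ha₀]; exact ha

/-- The weights of the first LLA step are small inside the blocks and large between them. -/
theorem llaWeight_bounds (hτ : 0 ≤ τ) (hg : IsScadLike a₀ a₁ b₁ b₂ τ g)
    (hK : numComp βs < d) (hgap : β₀ ∈ evalGapSet βs (b₁ * τ) (b₂ * τ))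
    (hop : opNorm (lapResid β₀ βs) / specGap βs ≤
      min ρ (1 / 2 ^ 6 * Real.sqrt (a₁ / (a₀ * maxComp βs)))) :
    (∀ e ∈ blockSupp βs, llaWeight a₀ τ g β₀ e ≤ 2 ^ 5 * a₀ * τ * ρ ^ 2) ∧
    (∀ e, e ∉ blockSupp βs →
      a₁ * τ / (4 * maxComp βs) ≤ 1 / 2 * llaWeight a₀ τ g β₀ e) ∧
    (min (frobNorm (lapResid β₀ βs)) (Real.sqrt (numComp βs) * opNorm (lapResid β₀ βs)) ≤
        specGap βs * ρ →
      ∑ e ∈ blockSupp βs, llaWeight a₀ τ g β₀ e ≤ 2 ^ 4 * (maxComp βs : ℝ) * a₀ * τ * ρ ^ 2) := by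
  -- for `τ = 0` the two eigenvalue thresholds coincide, but all weights and bounds are zero
  rcases hτ.eq_or_lt with rfl | hτ'
  · simp [llaWeight_eq_zero_of_tau hg]
  have hΔ := specGap_pos βs hK
  have ha₁ := hg.a₁_pos
  have ha₀ : 0 < a₀ := ha₁.trans_le hg.a₁_le
  set m : ℝ := (maxComp βs : ℝ) with hm
  have hm1 : 1 ≤ m := by
    rw [hm]
    exact_mod_cast maxComp_pos βs (by omega)
  have hm0 : 0 < m := by linarith
  set ε := opNorm (lapResid β₀ βs) / specGap βs with hεdef
  have hε0 : 0 ≤ ε := div_nonneg (opNorm_nonneg _) hΔ.le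
  have hερ : ε ≤ ρ := hop.trans (min_le_left _ _)
  have hεm := eps_sq_mul_le ha₁ hg.a₁_le hm0 hε0 (hop.trans (min_le_right _ _))
  have hε64 : 64 * ε ≤ 1 := by
    refine le_of_sq_le_sq ?_ zero_le_one
    nlinarith [sq_nonneg (64 * ε)]
  obtain ⟨T, hP, hw⟩ := exists_spectralPerturbation hτ' hg hK hgap (by linarith)
  refine ⟨fun e he => ?_, fun e he => ?_, fun hF => ?_⟩
  · have h1 := hP.sum_inner_sq_le_of_mem_orthogonal (edgeVec_mem_orthogonal βs he)
    rw [norm_edgeVec_sq] at h1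
    have h2 : ε ^ 2 ≤ ρ ^ 2 := by gcongr
    calc _ ≤ _ := (hw e).2
      _ ≤ a₀ * τ * (2 ^ 5 * ρ ^ 2) := by gcongr; nlinarith
      _ = _ := by ring
  · obtain ⟨z, hz, hxz, hzm⟩ := exists_mem_locConst_of_notMem_blockSupp βs he
    rw [← hm] at hzm
    -- the edge vector is longer than `z` by at most a factor `√m`, which `ε` compensates
    have hxε : 64 * (ε * ‖edgeVec e‖) ≤ ‖z‖ := by
      refine le_of_sq_le_sq ?_ (norm_nonneg _)
      refine le_trans ?_ hzm
      rw [le_div_iff₀ hm0, mul_pow, mul_pow, norm_edgeVec_sq]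
      nlinarith
    have h1 := hP.le_sum_inner_sq hz hxz (by nlinarith [norm_nonneg z])
    have h2 : 31 / 32 * ‖z‖ ≤ (1 - ε) * ‖z‖ - ε * ‖edgeVec e‖ := by nlinarith [norm_nonneg z]
    set X := ∑ k ∈ T, inner ℝ ((lap_absVec_isHermitian β₀).eigenvectorBasis k) (edgeVec e) ^ 2
    have hX : 0 ≤ X := Finset.sum_nonneg fun _ _ => sq_nonneg _
    have h3 : 1 / m ≤ X := by
      have h4 : (31 / 32 * ‖z‖) ^ 2 ≤ X := by
        calc _ ≤ ((1 - ε) * ‖z‖ - ε * ‖edgeVec e‖) ^ 2 := by gcongr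
          _ ≤ (1 - ε) ^ 2 * X := h1
          _ ≤ 1 * X := by
            gcongr
            rw [sq_le_one_iff₀ (by linarith)]; linarith
          _ = X := one_mul X
      have h5 : 1 / m = 1 / 2 * (2 / m) := by ring
      nlinarith
    have h6 := (hw e).1
    have h7 : a₁ * τ * (1 / m) ≤ a₁ * τ * X := by gcongr
    have h8 : a₁ * τ / (4 * m) = 1 / 4 * (a₁ * τ * (1 / m)) := by field_simp
    have h9 : 0 ≤ a₁ * τ * (1 / m) := by positivity
    rw [h8]
    linarith
  · set U := locConst (supportGraph βs)
    set bs := (lap_absVec_isHermitian β₀).eigenvectorBasis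
    have h1 := hP.sum_norm_sub_starProjection_sq_le (stdOrthonormalBasis ℝ U)
    have hon : Orthonormal ℝ fun j => (stdOrthonormalBasis ℝ U j : EuclideanSpace ℝ (Fin d)) :=
      (stdOrthonormalBasis ℝ U).orthonormal.comp_linearIsometry U.subtypeₗᵢ
    have h2 : ∑ j, ‖euclOp (lapResid β₀ βs)
        (stdOrthonormalBasis ℝ U j : EuclideanSpace ℝ (Fin d))‖ ^ 2 ≤ (specGap βs * ρ) ^ 2 := by
      rcases min_le_iff.1 hF with h | h
      · refine (sum_norm_euclOp_sq_le_frobNorm_sq _ hon).trans ?_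
        have : 0 ≤ frobNorm (lapResid β₀ βs) := Real.sqrt_nonneg _
        gcongr
      · refine (sum_norm_euclOp_sq_le_opNorm_sq _ hon).trans ?_
        rw [Fintype.card_fin, finrank_locConst_supportGraph]
        have h3 : 0 ≤ Real.sqrt (numComp βs) * opNorm (lapResid β₀ βs) :=
          mul_nonneg (Real.sqrt_nonneg _) (opNorm_nonneg _)
        calc _ = (Real.sqrt (numComp βs) * opNorm (lapResid β₀ βs)) ^ 2 := by
              rw [mul_pow, Real.sq_sqrt (Nat.cast_nonneg _)]
          _ ≤ _ := by gcongr
    simp only [euclOp_lapResid] at h2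
    set Y := ∑ k ∈ T, ‖bs k - U.starProjection (bs k)‖ ^ 2
    have hY0 : 0 ≤ Y := Finset.sum_nonneg fun _ _ => sq_nonneg _
    have hY : Y ≤ 2 * ρ ^ 2 := by
      have h4 : (1 - ε) ^ 2 * Y ≤ ρ ^ 2 := by
        refine le_of_mul_le_mul_left ?_ (pow_pos hΔ 2)
        calc _ = ((1 - ε) * specGap βs) ^ 2 * Y := by ring
          _ ≤ _ := h1.trans h2
          _ = _ := by ring
      have h5 : 1 / 2 ≤ (1 - ε) ^ 2 := by nlinarith
      nlinarith
    calc ∑ e ∈ blockSupp βs, llaWeight a₀ τ g β₀ e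
        ≤ ∑ e ∈ blockSupp βs, a₀ * τ * ∑ k ∈ T, inner ℝ (bs k) (edgeVec e) ^ 2 :=
          Finset.sum_le_sum fun e _ => (hw e).2
      _ = a₀ * τ * ∑ k ∈ T, ∑ e ∈ blockSupp βs, (bs k e.1.1 - bs k e.1.2) ^ 2 := by
          rw [← Finset.mul_sum, Finset.sum_comm]
          simp only [inner_edgeVec_right]
      _ ≤ a₀ * τ * ∑ k ∈ T, m * ‖bs k - U.starProjection (bs k)‖ ^ 2 := by
          gcongr with k
          exact sum_blockSupp_sq_le βs _ _ (U.starProjection_apply_mem _)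
      _ = a₀ * τ * (m * Y) := by simp only [Y, Finset.mul_sum]
      _ ≤ a₀ * τ * (m * (2 ^ 4 * ρ ^ 2)) := by gcongr; nlinarith [sq_nonneg ρ]
      _ = _ := by ring

/-- At a block supported point with well connected blocks, the weights of the LLA step vanish inside
the blocks and stay large between them. -/
theorem llaWeight_of_mem_bigEvalCompSet (hτ : 0 ≤ τ) (hg : IsScadLike a₀ a₁ b₁ b₂ τ g)
    (hd : 0 < d) (hβ : ∀ e, e ∉ blockSupp βs → β e = 0) (hmem : β ∈ bigEvalCompSet βs (b₂ * τ)) :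
    (∀ e ∈ blockSupp βs, llaWeight a₀ τ g β e = 0) ∧
    (∀ e, e ∉ blockSupp βs →
      a₁ * τ / (4 * maxComp βs) ≤ 1 / 2 * llaWeight a₀ τ g β e) := by
  rcases hτ.eq_or_lt with rfl | hτ'
  · simp [llaWeight_eq_zero_of_tau hg]
  have ha₀ : 0 < a₀ := hg.a₁_pos.trans_le hg.a₁_le
  have hm0 : (0 : ℝ) < maxComp βs := by exact_mod_cast maxComp_pos βs hd
  set hA := lap_absVec_isHermitian β
  set L := euclOp (lap (adj (absVec β)))
  set U := locConst (supportGraph βs)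
  set bs := hA.eigenvectorBasis
  have ht : 0 < b₂ * τ := mul_pos (hg.b₁_pos.trans hg.b₁_lt) hτ'
  have hker : ∀ u ∈ U, L u = 0 := fun u hu => euclOp_lap_eq_zero_of_mem_locConst βs hβ hu
  have hcoef : ∀ u ∈ U, ∀ k, hA.eigenvalues k * inner ℝ (bs k) u = 0 := fun u hu k => by
    rw [← inner_apply_of_eigen bs (euclOp_eigenvectorBasis hA)]
    change inner ℝ (bs k) (L u) = 0
    rw [hker u hu, inner_zero_right]
  constructor
  · intro e he
    refine Finset.sum_eq_zero fun k _ => ?_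
    by_cases hk : b₂ * τ ≤ hA.eigenvalues k
    · rw [hg.deriv_flat _ hk, zero_mul]
    -- an eigenvector with a small eigenvalue is locally constant
    set q := bs k - U.starProjection (bs k) with hq
    have hqU : q ∈ Uᗮ := U.sub_starProjection_mem_orthogonal _
    have h1 := mul_norm_sq_le_of_mem_bigEvalCompSet βs ht hmem hqU
    have h2 : L q = hA.eigenvalues k • bs k := by
      rw [hq, map_sub, hker _ (U.starProjection_apply_mem _), sub_zero]
      exact euclOp_eigenvectorBasis hA k
    have h3 : inner ℝ (bs k) q = ‖q‖ ^ 2 := by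
      have h4 : bs k = q + U.starProjection (bs k) := by rw [hq, sub_add_cancel]
      rw [← real_inner_self_eq_norm_sq]
      conv_lhs => rw [h4]
      rw [inner_add_left, hqU _ (U.starProjection_apply_mem _), add_zero]
    change b₂ * τ * ‖q‖ ^ 2 ≤ inner ℝ (L q) q at h1
    rw [h2, inner_smul_left, h3] at h1
    have hq0 : q = 0 := by
      by_contra h
      have h5 : 0 < ‖q‖ ^ 2 := by have := norm_pos_iff.2 h; positivity
      exact hk (le_of_mul_le_mul_right (by simpa using h1) h5)
    have hbU : bs k ∈ U := by
      rw [sub_eq_zero.1 (hq.symm.trans hq0)]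
      exact U.starProjection_apply_mem _
    have h6 := edgeVec_mem_orthogonal βs he (bs k) hbU
    change penDeriv a₀ τ g (hA.eigenvalues k) * inner ℝ (bs k) (edgeVec e) ^ 2 = 0
    rw [h6]; ring
  · intro e he
    obtain ⟨z, hz, hxz, hzm⟩ := exists_mem_locConst_of_notMem_blockSupp βs he
    have hz0 : 0 < ‖z‖ ^ 2 := lt_of_lt_of_le (by positivity) hzm
    set T := Finset.univ.filter fun k => hA.eigenvalues k = 0 with hT
    have h1 : ‖z‖ ^ 2 = ∑ k ∈ T, inner ℝ (bs k) (edgeVec e) * inner ℝ (bs k) z := by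
      rw [← hxz, ← bs.sum_inner_mul_inner]
      symm
      simp only [real_inner_comm (edgeVec e)]
      refine Finset.sum_subset (Finset.subset_univ _) fun k _ hk => ?_
      have : inner ℝ (bs k) z = 0 :=
        (mul_eq_zero.1 (hcoef z hz k)).resolve_left (by simpa [hT] using hk)
      rw [this, mul_zero]
    have h2 : ∑ k ∈ T, inner ℝ (bs k) z ^ 2 ≤ ‖z‖ ^ 2 := by
      rw [← bs.sum_sq_inner_right z]
      exact Finset.sum_le_sum_of_subset_of_nonneg (Finset.subset_univ _)
        fun _ _ _ => sq_nonneg _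
    have cs := Finset.sum_mul_sq_le_sq_mul_sq T (fun k => inner ℝ (bs k) (edgeVec e))
      (fun k => inner ℝ (bs k) z)
    rw [← h1] at cs
    set X := ∑ k ∈ T, inner ℝ (bs k) (edgeVec e) ^ 2
    have hX : 0 ≤ X := Finset.sum_nonneg fun _ _ => sq_nonneg _
    have h3 : 2 / (maxComp βs : ℝ) ≤ X := by
      refine hzm.trans (le_of_mul_le_mul_right ?_ hz0)
      rw [← sq]
      exact cs.trans (by gcongr)
    have h4 : a₀ * τ * X ≤ llaWeight a₀ τ g β e := by
      rw [Finset.mul_sum]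
      refine le_trans (Finset.sum_le_sum fun k hk => ?_)
        (Finset.sum_le_sum_of_subset_of_nonneg (Finset.subset_univ T) fun k _ _ =>
          mul_nonneg (hg.penDeriv_nonneg hτ _) (sq_nonneg _))
      have : hA.eigenvalues k = 0 := by simpa [hT] using hk
      change _ ≤ penDeriv a₀ τ g (hA.eigenvalues k) * inner ℝ (bs k) (edgeVec e) ^ 2
      rw [this, penDeriv, if_neg (lt_irrefl _)]
    have h5 : a₁ * τ * (2 / maxComp βs) ≤ a₀ * τ * X := by
      have := hg.a₁_le
      gcongr
    have h6 : a₁ * τ / (4 * maxComp βs) = 1 / 8 * (a₁ * τ * (2 / maxComp βs)) := by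
      field_simp; ring
    have h7 : 0 ≤ a₁ * τ * (2 / (maxComp βs : ℝ)) := by have := hg.a₁_pos; positivity
    rw [h6]
    linarith

end Steps

/-! ### Convergence of the LLA iteration -/

section Convergence

variable {d : ℕ} {ℓ : (Edge d → ℝ) → ℝ} {βs β₀ βorc : Edge d → ℝ} {g : ℝ → ℝ}
  {a₀ a₁ b₁ b₂ τ ρ : ℝ}

theorem isWeight_zero : IsWeight βs 0 := ⟨fun _ => le_rfl, fun _ _ => rfl⟩

theorem isLassoOracle_zero_iff {β : Edge d → ℝ} :
    IsLassoOracle ℓ βs 0 β ↔ IsBlockOracle ℓ βs β := by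
  simp [IsLassoOracle, IsBlockOracle]

/-- The weights of the LLA step from `β`, restricted to the block support. -/
def blockWeight (a₀ τ : ℝ) (g : ℝ → ℝ) (βs β : Edge d → ℝ) (e : Edge d) : ℝ :=
  if e ∈ blockSupp βs then llaWeight a₀ τ g β e else 0

theorem isWeight_blockWeight (hτ : 0 ≤ τ) (hg : IsScadLike a₀ a₁ b₁ b₂ τ g) (β : Edge d → ℝ) :
    IsWeight βs (blockWeight a₀ τ g βs β) := by
  constructor
  · intro e
    rw [blockWeight]
    split_ifs
    exacts [llaWeight_nonneg hg hτ _ _, le_rfl]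
  · intro e he
    rw [blockWeight, if_neg he]

theorem sum_blockWeight (f : ℝ → ℝ) (hf : f 0 = 0) (β : Edge d → ℝ) :
    ∑ e, f (blockWeight a₀ τ g βs β e) = ∑ e ∈ blockSupp βs, f (llaWeight a₀ τ g β e) := by
  rw [← Finset.sum_add_sum_compl (blockSupp βs),
    Finset.sum_eq_zero (s := (blockSupp βs)ᶜ), add_zero]
  · exact Finset.sum_congr rfl fun e he => by rw [blockWeight, if_pos he]
  · intro e he
    rw [blockWeight, if_neg (by simpa using he), hf]

/-- Two LLA steps reach the block oracle, for any set `O` of block supported points containing the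
block oracle and the Lasso oracle whose weights come from the first step. -/
theorem lla_convergence {O : Set (Edge d → ℝ)} (hτ : 0 ≤ τ) (hd : 0 < d)
    (hℓ : ConvexOn ℝ univ ℓ) (hg : IsScadLike a₀ a₁ b₁ b₂ τ g)
    (horc : ∀ β, IsBlockOracle ℓ βs β ↔ β = βorc)
    (huniq : ∀ w, IsWeight βs w → ∃! β, IsLassoOracle ℓ βs w β)
    (hlow : ∀ e, e ∉ blockSupp βs →
      a₁ * τ / (4 * maxComp βs) ≤ 1 / 2 * llaWeight a₀ τ g β₀ e)
    (hO : ∀ β ∈ O, ∀ e, e ∉ blockSupp βs → β e = 0) (horcO : βorc ∈ O)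
    (hstep : ∀ β, IsLassoOracle ℓ βs (blockWeight a₀ τ g βs β₀) β → β ∈ O)
    (hnice : O ⊆ niceGradSet ℓ βs (a₁ * τ / (4 * maxComp βs))) :
    (∃! β₁, IsLLAStep ℓ a₀ τ g β₀ β₁) ∧
      (∀ β₁, IsLLAStep ℓ a₀ τ g β₀ β₁ → β₁ ∈ O) ∧
      (O ⊆ bigEvalCompSet βs (b₂ * τ) →
        (∀ β₁, IsLLAStep ℓ a₀ τ g β₀ β₁ → ∀ β₂, IsLLAStep ℓ a₀ τ g β₁ β₂ ↔ β₂ = βorc) ∧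
        (∀ β₃, IsLLAStep ℓ a₀ τ g βorc β₃ ↔ β₃ = βorc)) := by
  obtain ⟨β₁, h1, h1u⟩ := huniq _ (isWeight_blockWeight (βs := βs) hτ hg β₀)
  have hfirst : ∀ β, IsLLAStep ℓ a₀ τ g β₀ β ↔ β = β₁ := fun β => by
    rw [isLLAStep_iff]
    exact h1.minimizer_iff hℓ h1u (isWeight_blockWeight hτ hg β₀) (hnice (hstep _ h1))
      (fun e he => by rw [blockWeight, if_pos he]) hlow
  have hsecond : O ⊆ bigEvalCompSet βs (b₂ * τ) → ∀ β ∈ O, ∀ β',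
      IsLLAStep ℓ a₀ τ g β β' ↔ β' = βorc := fun hbig β hβ β' => by
    obtain ⟨hin, hout⟩ := llaWeight_of_mem_bigEvalCompSet hτ hg hd (hO β hβ) (hbig hβ)
    rw [isLLAStep_iff]
    exact (isLassoOracle_zero_iff.2 ((horc βorc).2 rfl)).minimizer_iff hℓ
      (fun b hb => (horc b).1 (isLassoOracle_zero_iff.1 hb)) isWeight_zero (hnice horcO) hin hout
  refine ⟨⟨β₁, (hfirst β₁).2 rfl, fun β hβ => (hfirst β).1 hβ⟩, fun β hβ => ?_, fun hbig =>
    ⟨fun β hβ => ?_, hsecond hbig βorc horcO⟩⟩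
  · rw [(hfirst β).1 hβ]; exact hstep _ h1
  · rw [(hfirst β).1 hβ]; exact hsecond hbig β₁ (hstep _ h1)

end Convergence

end BlockLLA

end

theorem mainTheorem1 {d : ℕ} (ℓ : (BlockLLA.Edge d → ℝ) → ℝ)
    (βs β₀ βorc : BlockLLA.Edge d → ℝ) (g : ℝ → ℝ) (a₀ a₁ b₁ b₂ τ ρ : ℝ)
    (hτ : 0 ≤ τ) (hρ : 0 ≤ ρ)
    (hℓ : ConvexOn ℝ Set.univ ℓ)
    (hg : BlockLLA.IsScadLike a₀ a₁ b₁ b₂ τ g)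
    (hK : BlockLLA.numComp βs < d)
    (horc : ∀ β, BlockLLA.IsBlockOracle ℓ βs β ↔ β = βorc)
    (huniq : ∀ w, BlockLLA.IsWeight βs w → ∃! β, BlockLLA.IsLassoOracle ℓ βs w β)
    (hgap : β₀ ∈ BlockLLA.evalGapSet βs (b₁ * τ) (b₂ * τ)) :
    (BlockLLA.opNorm (BlockLLA.lapResid β₀ βs) / BlockLLA.specGap βs ≤
        min ρ (1 / 2 ^ 6 * Real.sqrt (a₁ / (a₀ * BlockLLA.maxComp βs))) →
      BlockLLA.lassoOrcSetOp ℓ βs a₀ ρ τ ⊆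
        BlockLLA.niceGradSet ℓ βs (a₁ * τ / (4 * BlockLLA.maxComp βs)) →
      (∃! β₁, BlockLLA.IsLLAStep ℓ a₀ τ g β₀ β₁) ∧
      (∀ β₁, BlockLLA.IsLLAStep ℓ a₀ τ g β₀ β₁ → β₁ ∈ BlockLLA.lassoOrcSetOp ℓ βs a₀ ρ τ) ∧
      (BlockLLA.lassoOrcSetOp ℓ βs a₀ ρ τ ⊆ BlockLLA.bigEvalCompSet βs (b₂ * τ) →
        (∀ β₁, BlockLLA.IsLLAStep ℓ a₀ τ g β₀ β₁ →
          ∀ β₂, BlockLLA.IsLLAStep ℓ a₀ τ g β₁ β₂ ↔ β₂ = βorc) ∧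
        (∀ β₃, BlockLLA.IsLLAStep ℓ a₀ τ g βorc β₃ ↔ β₃ = βorc))) ∧
    (min (BlockLLA.frobNorm (BlockLLA.lapResid β₀ βs))
          (Real.sqrt (BlockLLA.numComp βs) * BlockLLA.opNorm (BlockLLA.lapResid β₀ βs)) ≤
        BlockLLA.specGap βs *
          min ρ (1 / 2 ^ 6 * Real.sqrt (a₁ / (a₀ * BlockLLA.maxComp βs))) →
      BlockLLA.lassoOrcSetFrob ℓ βs a₀ ρ τ ⊆
        BlockLLA.niceGradSet ℓ βs (a₁ * τ / (4 * BlockLLA.maxComp βs)) →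
      (∃! β₁, BlockLLA.IsLLAStep ℓ a₀ τ g β₀ β₁) ∧
      (∀ β₁, BlockLLA.IsLLAStep ℓ a₀ τ g β₀ β₁ → β₁ ∈ BlockLLA.lassoOrcSetFrob ℓ βs a₀ ρ τ) ∧
      (BlockLLA.lassoOrcSetFrob ℓ βs a₀ ρ τ ⊆ BlockLLA.bigEvalCompSet βs (b₂ * τ) →
        (∀ β₁, BlockLLA.IsLLAStep ℓ a₀ τ g β₀ β₁ →
          ∀ β₂, BlockLLA.IsLLAStep ℓ a₀ τ g β₁ β₂ ↔ β₂ = βorc) ∧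
        (∀ β₃, BlockLLA.IsLLAStep ℓ a₀ τ g βorc β₃ ↔ β₃ = βorc))) := by
  open BlockLLA in
  have hd : 0 < d := by omega
  have hΔ := specGap_pos βs hK
  have ha₀ : 0 < a₀ := hg.a₁_pos.trans_le hg.a₁_le
  have hW := isWeight_blockWeight (βs := βs) hτ hg β₀
  have horc0 := isLassoOracle_zero_iff.2 ((horc βorc).2 rfl)
  have hmax : (∀ e ∈ blockSupp βs, llaWeight a₀ τ g β₀ e ≤ 2 ^ 5 * a₀ * τ * ρ ^ 2) →
      ∀ e, |blockWeight a₀ τ g βs β₀ e| ≤ 2 ^ 5 * a₀ * τ * ρ ^ 2 := fun h e => by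
    rw [abs_of_nonneg (hW.1 e), blockWeight]
    split_ifs with he
    · exact h e he
    · positivity
  constructor
  · intro hop hnice
    obtain ⟨hup, hlow, -⟩ := llaWeight_bounds hτ hg hK hgap hop
    refine lla_convergence hτ hd hℓ hg horc huniq hlow ?_ ?_ ?_ hnice
    · rintro β ⟨w, -, -, hβ⟩
      exact hβ.1
    · exact ⟨0, isWeight_zero, fun e => by simp only [Pi.zero_apply, abs_zero]; positivity, horc0⟩
    · exact fun β hβ => ⟨_, hW, hmax hup, hβ⟩
  · intro hF hnice
    have hop : opNorm (lapResid β₀ βs) / specGap βs ≤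
        min ρ (1 / 2 ^ 6 * Real.sqrt (a₁ / (a₀ * maxComp βs))) := by
      -- there is at least one component, so both Frobenius-type quantities dominate `opNorm`
      rw [div_le_iff₀' hΔ]
      refine le_trans (le_min (opNorm_le_frobNorm _) ?_) hF
      have h1 : 1 ≤ Real.sqrt (numComp βs) := by
        rw [Real.one_le_sqrt]
        exact_mod_cast numComp_pos βs hd
      exact le_mul_of_one_le_left (opNorm_nonneg _) h1
    obtain ⟨hup, hlow, hsum⟩ := llaWeight_bounds hτ hg hK hgap hop
    have hsum := hsum (hF.trans (mul_le_mul_of_nonneg_left (min_le_left _ _) hΔ.le))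
    refine lla_convergence hτ hd hℓ hg horc huniq hlow ?_ ?_ ?_ hnice
    · rintro β ⟨w, -, -, -, -, hβ⟩
      exact hβ.1
    · refine ⟨0, isWeight_zero, fun e => ?_, ?_, ?_, horc0⟩
      · simp only [Pi.zero_apply, abs_zero]; positivity
      · simp; positivity
      · simp; positivity
    · refine fun β hβ => ⟨_, hW, hmax hup, ?_, ?_, hβ⟩
      · rw [Real.sqrt_le_iff]
        refine ⟨by positivity, ?_⟩
        rw [sum_blockWeight (fun x => x ^ 2) (by simp)]
        have h2 : ((2 : ℝ) ^ (9 / 2 : ℝ)) ^ 2 = 2 ^ 9 := by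
          rw [← Real.rpow_natCast, ← Real.rpow_mul (by norm_num)]
          norm_num
        -- the squared Euclidean norm is at most the product of the maximum norm and the `ℓ¹` norm
        calc ∑ e ∈ blockSupp βs, llaWeight a₀ τ g β₀ e ^ 2
            ≤ ∑ e ∈ blockSupp βs, 2 ^ 5 * a₀ * τ * ρ ^ 2 * llaWeight a₀ τ g β₀ e := by
              refine Finset.sum_le_sum fun e he => ?_
              rw [sq]
              exact mul_le_mul_of_nonneg_right (hup e he) (llaWeight_nonneg hg hτ _ _)
          _ ≤ 2 ^ 5 * a₀ * τ * ρ ^ 2 * (2 ^ 4 * (maxComp βs : ℝ) * a₀ * τ * ρ ^ 2) := by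
              rw [← Finset.mul_sum]
              gcongr
          _ = _ := by
              simp only [mul_pow, h2, Real.sq_sqrt (Nat.cast_nonneg (maxComp βs))]
              ring
      · rw [sum_blockWeight (fun x => |x|) (by simp)]
        refine le_trans (le_of_eq ?_) hsum
        exact Finset.sum_congr rfl fun e _ => abs_of_nonneg (llaWeight_nonneg hg hτ _ _)
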